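/- Let $G\subseteq\mathbb{R}^d$ with Borel $\sigma$-algebra $\mathcal{B}(G)$, let $K$ be a Markov transition kernel on $(G,\mathcal{B}(G))$ that is reversible with respect to a probability measure $\pi$, i.e. $\int_A K(x,B)\,\pi(dx)=\int_B K(x,A)\,\pi(dx)$ for all $A,B\in\mathcal{B}(G)$. Let $L_2=L_2(\pi)$ (real-valued functions, norm $\|\cdot\|_2$), $L_2^0=\{f\in L_2:\int f\,d\pi=0\}$, let $Pf(x)=\int_G f(y)\,K(x,dy)$ be the Markov operator on $L_2$, which maps $L_2^0$ into itself, and put $$\Lambda=\sup\operatorname{spec}(P|_{L_2^0}),\qquad \Lambda_0=\max\{0,\Lambda\}$$ (with $\Lambda_0=0$ if $L_2^0=\{0\}$). Assume that $K$ is variance bounding, i.e. $\Lambda<1$. Let $\nu$ be a probability measure on $(G,\mathcal{B}(G))$ that has a density $\frac{d\nu}{d\pi}\in L_2$. Let $\mathscr{A}\subseteq\mathcal{B}(G)$, let $\delta>0$, and let $\Gamma_\delta\subseteq\mathcal{B}(G)$ be a finite $\delta$-cover of $\mathscr{A}$ with respect to $\pi$, i.e. $\emptyset\in\Gamma_\delta$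 and for every $A\in\mathscr{A}$ there are $C,D\in\Gamma_\delta$ with $C\subseteq A\subseteq D$ and $\pi(D\setminus C)\le\delta$. Let $\varphi\colon G\times[0,1]^s\to G$ be any update function of $K$ (measurable, with $K(x,A)=\lambda_s(\{u\in[0,1]^s:\varphi(x;u)\in A\})$ for all $x\in G$, $A\in\mathcal{B}(G)$) and let $\psi\colon[0,1]^s\to G$ be any generator function of $\nu$ (measurable, with $\nu(A)=\lambda_s(\{u\in[0,1]^s:\psi(u)\in A\})$ for all $A\in\mathcal{B}(G)$), where $\lambda_k$ is the Lebesgue measure on $[0,1]^k$. Put $\varphi_0(x)=x$, $\varphi_{i}(x;u_1,\dots,u_{i})=\varphi(\varphi_{i-1}(x;u_1,\dots,u_{i-1});u_{i})$ for $i\ge1$, and $$C_{i,\psi}(A)=\{(u_0,\dots,u_i)\in[0,1]^{(i+1)s}:\varphi_i(\psi(u_0);u_1,\dots,u_i)\in A\},\qquad i\ge 0.$$ For a driver sequence $\mathcal{U}_n=(u_0,\dots,u_{n-1})$ in $[0,1]^s$ the pull-back discrepancy is $$D^*_{\mathscr{A},\psi,\varphi}(\mathcal{U}_n)=\sup_{A\in\mathscr{A}}\left|\frac1n\sum_{i=0}^{n-1}\Big[1_{(u_0,\dots,u_i)\in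 C_{i,\psi}(A)}-\lambda_{(i+1)s}(C_{i,\psi}(A))\Big]\right|$$ (a supremum over the empty set being $0$). Then for every integer $n\ge1$ there exists a driver sequence $\mathcal{U}_n=(u_0,\dots,u_{n-1})$ in $[0,1]^s$ such that $$D^*_{\mathscr{A},\psi,\varphi}(\mathcal{U}_n)\le\sqrt{\frac{1+\Lambda_0}{1-\Lambda_0}}\cdot\frac{\sqrt{2\log\big(|\Gamma_\delta|^2\,\|\frac{d\nu}{d\pi}\|_2\big)}}{\sqrt n}+\frac{1-\Lambda_0^n}{n(1-\Lambda_0)}\left\|\frac{d\nu}{d\pi}-1\right\|_2+\delta .$$ -/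

import Mathlib

open MeasureTheory ProbabilityTheory
open scoped ENNReal

namespace PullBack

noncomputable section

section MarkovOperator

variable {α : Type*} [MeasurableSpace α] {K : Kernel α α} {π : Measure α}

/-- Kernel averages of a square integrable function are square integrable with respect to an
invariant probability measure, and averaging does not increase the `L₂` norm. -/
theorem eLpNorm_kernelMean_le [IsMarkovKernel K] (hK : K.Invariant π)
    {f : α → ℝ} (hf : StronglyMeasurable f) :
    eLpNorm (fun x => ∫ y, f y ∂(K x)) 2 π ≤ eLpNorm f 2 π := by
  have key : ∀ x, ‖∫ y, f y ∂(K x)‖ₑ ^ (2 : ℝ) ≤ ∫⁻ y, ‖f y‖ₑ ^ (2 : ℝ) ∂(K x) := by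
    intro x
    have h1 : ‖∫ y, f y ∂(K x)‖ₑ ≤ eLpNorm f 1 (K x) := by
      rw [eLpNorm_one_eq_lintegral_enorm]
      exact enorm_integral_le_lintegral_enorm f
    have h2 : eLpNorm f 1 (K x) ≤ eLpNorm f 2 (K x) :=
      eLpNorm_le_eLpNorm_of_exponent_le (by norm_num) hf.aestronglyMeasurable
    have h3 : eLpNorm f 2 (K x) ^ (2 : ℝ) = ∫⁻ y, ‖f y‖ₑ ^ (2 : ℝ) ∂(K x) := by
      simpa using eLpNorm_nnreal_pow_eq_lintegral (f := f) (μ := K x) (p := 2) (by norm_num)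
    rw [← h3]
    exact ENNReal.rpow_le_rpow (h1.trans h2) (by norm_num)
  have h4 : ∀ g : α → ℝ, eLpNorm g 2 π ^ (2 : ℝ) = ∫⁻ y, ‖g y‖ₑ ^ (2 : ℝ) ∂π := fun g => by
    simpa using eLpNorm_nnreal_pow_eq_lintegral (f := g) (μ := π) (p := 2) (by norm_num)
  have h5 : ∫⁻ x, ∫⁻ y, ‖f y‖ₑ ^ (2 : ℝ) ∂(K x) ∂π = ∫⁻ y, ‖f y‖ₑ ^ (2 : ℝ) ∂π := by
    conv_rhs => rw [← hK.def]
    rw [Measure.lintegral_bind K.aemeasurable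
      ((hf.enorm.pow_const (2 : ℝ)).aemeasurable)]
  rw [← ENNReal.rpow_le_rpow_iff (z := (2 : ℝ)) (by norm_num), h4, h4, ← h5]
  exact lintegral_mono key

theorem memLp_kernelMean [IsMarkovKernel K] (hK : K.Invariant π) (f : Lp ℝ 2 π) :
    MemLp (fun x => ∫ y, f y ∂(K x)) 2 π :=
  ⟨((Lp.stronglyMeasurable f).integral_kernel).aestronglyMeasurable,
    (eLpNorm_kernelMean_le hK (Lp.stronglyMeasurable f)).trans_lt (Lp.eLpNorm_lt_top f)⟩

theorem kernelMean_congr (hK : K.Invariant π) {f g : α → ℝ} (h : f =ᵐ[π] g) :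
    (fun x => ∫ y, f y ∂(K x)) =ᵐ[π] fun x => ∫ y, g y ∂(K x) := by
  rw [← hK.def] at h
  filter_upwards [Measure.ae_ae_of_ae_comp h] with x hx using integral_congr_ae hx

theorem ae_integrable_kernel [IsProbabilityMeasure π] (hK : K.Invariant π) (f : Lp ℝ 2 π) :
    ∀ᵐ x ∂π, Integrable f (K x) := by
  have h : Integrable f π := (Lp.memLp f).integrable (by norm_num)
  have h' : Integrable f (π.bind K) := by rwa [hK.def]
  exact Measure.ae_integrable_of_integrable_comp h'

/-- The Markov operator `P f (x) = ∫ f(y) K(x, dy)` on the real Hilbert space `L₂(π)`, for a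
Markov kernel `K` with invariant probability measure `π`. -/
def markovOperator (K : Kernel α α) (π : Measure α) [IsMarkovKernel K] [IsProbabilityMeasure π]
    (hK : K.Invariant π) : Lp ℝ 2 π →L[ℝ] Lp ℝ 2 π :=
  LinearMap.mkContinuous
    { toFun := fun f => (memLp_kernelMean hK f).toLp (fun x => ∫ y, f y ∂(K x))
      map_add' := fun f g => by
        rw [← MemLp.toLp_add, MemLp.toLp_eq_toLp_iff]
        filter_upwards [kernelMean_congr hK (Lp.coeFn_add f g), ae_integrable_kernel hK f,
          ae_integrable_kernel hK g] with x hx hf hg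
        rw [hx]
        exact integral_add hf hg
      map_smul' := fun c f => by
        rw [RingHom.id_apply, ← MemLp.toLp_const_smul, MemLp.toLp_eq_toLp_iff]
        filter_upwards [kernelMean_congr hK (Lp.coeFn_smul c f)] with x hx
        rw [hx]
        exact integral_smul c _ }
    1 (fun f => by
      rw [one_mul]
      change ‖(memLp_kernelMean hK f).toLp (fun x => ∫ y, f y ∂(K x))‖ ≤ ‖f‖
      rw [Lp.norm_toLp, Lp.norm_def]
      exact ENNReal.toReal_mono (Lp.eLpNorm_ne_top f)
        (eLpNorm_kernelMean_le hK (Lp.stronglyMeasurable f)))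

theorem markovOperator_coeFn [IsMarkovKernel K] [IsProbabilityMeasure π] (hK : K.Invariant π)
    (f : Lp ℝ 2 π) : markovOperator K π hK f =ᵐ[π] fun x => ∫ y, f y ∂(K x) :=
  MemLp.coeFn_toLp (memLp_kernelMean hK f)

/-- The subspace `L₂⁰(π)` of the functions in `L₂(π)` with mean zero. -/
def L2Zero (π : Measure α) [IsProbabilityMeasure π] : Submodule ℝ (Lp ℝ 2 π) where
  carrier := {f | ∫ x, f x ∂π = 0}
  zero_mem' := by
    change ∫ x, (0 : Lp ℝ 2 π) x ∂π = 0
    rw [integral_congr_ae (Lp.coeFn_zero ℝ 2 π)]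
    simp
  add_mem' := fun {f g} hf hg => by
    change ∫ x, (f + g : Lp ℝ 2 π) x ∂π = 0
    rw [integral_congr_ae (Lp.coeFn_add f g)]
    change ∫ x, (f x + g x) ∂π = 0
    rw [integral_add ((Lp.memLp f).integrable (by norm_num))
      ((Lp.memLp g).integrable (by norm_num)), hf, hg, add_zero]
  smul_mem' := fun c f hf => by
    change ∫ x, (c • f : Lp ℝ 2 π) x ∂π = 0
    rw [integral_congr_ae (Lp.coeFn_smul c f)]
    change ∫ x, c • f x ∂π = 0
    rw [integral_smul, hf, smul_zero]

theorem markovOperator_mem_L2Zero [IsMarkovKernel K] [IsProbabilityMeasure π]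
    (hK : K.Invariant π) (f : Lp ℝ 2 π) (hf : f ∈ L2Zero π) :
    markovOperator K π hK f ∈ L2Zero π := by
  have h : Integrable f π := (Lp.memLp f).integrable (by norm_num)
  change ∫ x, markovOperator K π hK f x ∂π = 0
  rw [integral_congr_ae (markovOperator_coeFn hK f)]
  have h' : Integrable f (π.bind K) := by rwa [hK.def]
  rw [Measure.comp_eq_comp_const_apply] at h'
  have h2 := Kernel.integral_comp h'
  rw [← Measure.comp_eq_comp_const_apply, Kernel.const_apply, hK.def] at h2
  rw [← h2]
  exact hf

/-- The restriction of the Markov operator to `L₂⁰(π)`. -/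
def markovOperatorZero (K : Kernel α α) (π : Measure α) [IsMarkovKernel K]
    [IsProbabilityMeasure π] (hK : K.Invariant π) : L2Zero π →L[ℝ] L2Zero π :=
  (markovOperator K π hK).restrict (markovOperator_mem_L2Zero hK)

/-- `Λ = sup spec(P | L₂⁰(π))` for a kernel `K` reversible with respect to `π`. (The supremum
is `0` if `L₂⁰(π)` is trivial, in which case the spectrum is empty.) -/
def specSup (K : Kernel α α) (π : Measure α) [IsMarkovKernel K] [IsProbabilityMeasure π]
    (hK : K.IsReversible π) : ℝ :=
  sSup (spectrum ℝ (markovOperatorZero K π hK.invariant))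

/-- `K`, reversible with respect to `π`, is variance bounding (has an `L₂`-spectral gap). -/
def VarianceBounding (K : Kernel α α) (π : Measure α) [IsMarkovKernel K]
    [IsProbabilityMeasure π] (hK : K.IsReversible π) : Prop :=
  specSup K π hK < 1

/-- `Λ₀ = max {0, Λ}`. -/
def specSup₀ (K : Kernel α α) (π : Measure α) [IsMarkovKernel K] [IsProbabilityMeasure π]
    (hK : K.IsReversible π) : ℝ :=
  max 0 (specSup K π hK)

end MarkovOperator

section Discrepancy

/-- The unit cube `[0,1]^s`; its canonical measure `volume` is the Lebesgue measure. -/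
abbrev Cube (s : ℕ) : Type := Fin s → unitInterval

variable {α : Type*} [MeasurableSpace α] {s : ℕ}

/-- `φ` is an update function of the transition kernel `K`. -/
structure IsUpdateFunction (K : Kernel α α) (φ : α → Cube s → α) : Prop where
  measurable : Measurable (Function.uncurry φ)
  kernel_eq : ∀ x A, MeasurableSet A → K x A = volume {u | φ x u ∈ A}

/-- `ψ` is a generator function of the distribution `ν`. -/
structure IsGeneratorFunction (ν : Measure α) (ψ : Cube s → α) : Prop where
  measurable : Measurable ψ
  measure_eq : ∀ A, MeasurableSet A → ν A = volume {u | ψ u ∈ A}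

/-- `Γ` is a finite `δ`-cover of the set `𝒜` of test sets with respect to `π`. -/
structure IsDeltaCover (π : Measure α) (𝒜 : Set (Set α)) (δ : ℝ) (Γ : Finset (Set α)) :
    Prop where
  measurableSet : ∀ C ∈ Γ, MeasurableSet C
  empty_mem : ∅ ∈ Γ
  exists_bracket : ∀ A ∈ 𝒜, ∃ C ∈ Γ, ∃ D ∈ Γ, C ⊆ A ∧ A ⊆ D ∧ π.real (D \ C) ≤ δ

/-- The iterated update `φ_i(x; u_1, …, u_i)`. -/
def iterUpdate {β γ : Type*} (φ : β → γ → β) : (i : ℕ) → β → (Fin i → γ) → β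
  | 0, x, _ => x
  | i + 1, x, u => φ (iterUpdate φ i x (Fin.init u)) (u (Fin.last i))

/-- The set `C_{i,ψ}(A)` of all `(u_0, …, u_i)` with `φ_i(ψ(u_0); u_1, …, u_i) ∈ A`. -/
def pullBack {β γ : Type*} (φ : β → γ → β) (ψ : γ → β) (i : ℕ) (A : Set β) :
    Set (Fin (i + 1) → γ) :=
  {u | iterUpdate φ i (ψ (u 0)) (Fin.tail u) ∈ A}

/-- The local discrepancy function
`(1/n) ∑_{i=0}^{n-1} [1_{(u_0,…,u_i) ∈ C_{i,ψ}(A)} - λ_{(i+1)s}(C_{i,ψ}(A))]`. -/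
def localDiscrepancy {β : Type*} (φ : β → Cube s → β) (ψ : Cube s → β) {n : ℕ}
    (u : Fin n → Cube s) (A : Set β) : ℝ :=
  (1 / (n : ℝ)) * ∑ i : Fin n,
    ((pullBack φ ψ (i : ℕ) A).indicator (fun _ => (1 : ℝ))
        (fun j : Fin ((i : ℕ) + 1) => u (Fin.castLE i.isLt j))
      - (volume : Measure (Fin ((i : ℕ) + 1) → Cube s)).real (pullBack φ ψ (i : ℕ) A))

/-- The pull-back discrepancy of the driver sequence `u_0, …, u_{n-1}`. -/
def pullBackDiscrepancy {β : Type*} (𝒜 : Set (Set β)) (φ : β → Cube s → β) (ψ : Cube s → β)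
    {n : ℕ} (u : Fin n → Cube s) : ℝ :=
  ⨆ A : 𝒜, |localDiscrepancy φ ψ u (A : Set β)|

end Discrepancy

end

end PullBack

/-!
Under the stationary chain, the moment generating function at `θ` of the number of visits to a set
`B` among the first `k + 1` states is `⟨M 1, (M P M)ᵏ M 1⟩`, where `P` is the Markov operator and
`M` is multiplication by `exp (θ / 2 · 1_B)`. The spectral gap says that the quadratic form of `P`
is at most `Λ₀ ‖f‖² + (1 - Λ₀) (∫ f dπ)²`. Against this rank-one perturbation of a multiple of the
identity, Cauchy–Schwarz with the weight `R - Λ₀ exp (θ 1_B)` gives `‖M P M‖ ≤ R` as soon as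
`(1 - Λ₀) ∫ exp (θ 1_B) / (R - Λ₀ exp (θ 1_B)) dπ ≤ 1`, and
`R = exp (θ π(B) + θ² (1 + Λ₀) / (4 (1 - Λ₀)))` satisfies this secular inequality. Hence the visits
are sub-Gaussian under `π`. Cauchy–Schwarz transfers the tail bound to the initial distribution `ν`
at the cost of a square root and the factor `‖dν/dπ‖₂`, and a union bound over the nonempty sets of
`Γ_δ` produces a driver that is good for all of them. The bias of the chain started in `ν` is the
pairing of `dν/dπ - 1` with `∑ Pⁱ f` for mean-zero `f`, whose norm is at most `∑ Λ₀ⁱ ‖f‖`;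
monotonicity in the test set extends both bounds from the cover to `𝒜` at the price of `δ`.
-/

namespace PullBack

section ScalarBounds

open Real

theorem exp_le_one_add_add_mul_sinh {x : ℝ} (hx : 0 ≤ x) : exp x ≤ 1 + x + x * sinh x := by
  have hderiv (t : ℝ) : HasDerivAt (fun t : ℝ => 1 + t + t * sinh t - exp t)
      (1 + (1 * sinh t + t * cosh t) - exp t) t :=
    (((hasDerivAt_id t).const_add 1).add ((hasDerivAt_id t).mul (hasDerivAt_sinh t))).sub
      (hasDerivAt_exp t)
  have hmono : MonotoneOn (fun t : ℝ => 1 + t + t * sinh t - exp t) (Set.Ici 0) := by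
    refine monotoneOn_of_deriv_nonneg (convex_Ici 0) (by fun_prop) (by fun_prop) fun t ht => ?_
    have ht : 0 < t := by simpa using ht
    have hcosh : cosh t ≤ exp t := by
      rw [← cosh_add_sinh]
      linarith [sinh_nonneg_iff.2 ht.le]
    have hone : (1 - t) * cosh t ≤ 1 := calc
      (1 - t) * cosh t ≤ exp (-t) * exp t :=
        mul_le_mul (one_sub_le_exp_neg t) hcosh (cosh_pos t).le (exp_pos _).le
      _ = 1 := by rw [← exp_add, neg_add_cancel, exp_zero]
    rw [(hderiv t).deriv, ← cosh_add_sinh]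
    linarith
  simpa [sub_nonneg] using hmono Set.self_mem_Ici hx hx

theorem mul_cosh_add_mul_sinh_le_of_nonneg {c a x : ℝ} (hc : 1 ≤ c) (ha : a ≤ 1) (hx : 0 ≤ x) :
    c * cosh x + a * sinh x ≤ c * cosh (a * x + c * x ^ 2) + sinh (a * x + c * x ^ 2) := by
  have : 0 ≤ sinh x := sinh_nonneg_iff.2 hx
  obtain ⟨t, rfl⟩ : ∃ t, a = t - c * x := ⟨a + c * x, by ring⟩
  rw [show (t - c * x) * x + c * x ^ 2 = t * x by ring]
  rcases le_total 1 t with ht | ht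
  · have hxt : x ≤ t * x := le_mul_of_one_le_left hx ht
    have hcosh : cosh x ≤ cosh (t * x) := by
      rwa [cosh_le_cosh, abs_of_nonneg hx, abs_of_nonneg (hx.trans hxt)]
    calc c * cosh x + (t - c * x) * sinh x ≤ c * cosh (t * x) + 1 * sinh x := by gcongr
      _ ≤ c * cosh (t * x) + sinh (t * x) := by rw [one_mul]; gcongr; exact sinh_le_sinh.2 hxt
  · have hx_le : x ≤ sinh x := self_le_sinh_iff.2 hx
    have hexp : cosh x + sinh x ≤ 1 + x + x * sinh x := by
      rw [cosh_add_sinh]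
      exact exp_le_one_add_add_mul_sinh hx
    have htx : t * x + 1 ≤ cosh (t * x) + sinh (t * x) := by
      rw [cosh_add_sinh]
      exact add_one_le_exp _
    have hgap : 0 ≤ x * sinh x - cosh x + cosh (t * x) := by linarith [one_le_cosh (t * x)]
    have key : t * sinh x - sinh (t * x) ≤ c * (x * sinh x - cosh x + cosh (t * x)) := by
      refine le_trans ?_ (le_mul_of_one_le_left hgap hc)
      linarith [mul_nonneg (sub_nonneg.2 ht) (sub_nonneg.2 hx_le)]
    linarith

theorem mul_cosh_add_mul_sinh_le {c a x : ℝ} (hc : 1 ≤ c) (ha : -1 ≤ a) (ha' : a ≤ 1) :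
    c * cosh x + a * sinh x ≤ c * cosh (a * x + c * x ^ 2) + sinh (a * x + c * x ^ 2) := by
  rcases le_total 0 x with hx | hx
  · exact mul_cosh_add_mul_sinh_le_of_nonneg hc ha' hx
  · simpa using mul_cosh_add_mul_sinh_le_of_nonneg hc (neg_le.1 ha) (neg_nonneg.2 hx)

theorem mul_exp_abs_lt {l a x : ℝ} (hl : 0 ≤ l) (hl1 : l < 1) (ha : -1 ≤ a) (ha' : a ≤ 1) :
    l * exp |x| < exp (a * x + (1 + l) / (1 - l) * x ^ 2) := by
  have : 0 < 1 - l := sub_pos.2 hl1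
  obtain ⟨d, hd⟩ : ∃ d, d = (1 - l) / (1 + l) := ⟨_, rfl⟩
  have hd0 : 0 < d := by rw [hd]; positivity
  have hlt : l < exp (-d) := calc
    l ≤ -d + 1 := by
      rw [hd, neg_add_eq_sub, le_sub_comm, div_le_iff₀ (by positivity)]
      nlinarith
    _ < exp (-d) := add_one_lt_exp (neg_ne_zero.2 hd0.ne')
  have hax : -|x| ≤ a * x := neg_le_of_abs_le <| by
    rw [abs_mul]
    exact mul_le_of_le_one_left (abs_nonneg _) (abs_le.2 ⟨ha, ha'⟩)
  have hsq : 2 * |x| - d ≤ (1 + l) / (1 - l) * x ^ 2 := by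
    have : (1 + l) / (1 - l) * x ^ 2 - (2 * |x| - d) = (|x| - d) ^ 2 / d := by
      rw [← inv_div, ← hd, ← sq_abs x]
      field_simp
      ring
    linarith [div_nonneg (sq_nonneg (|x| - d)) hd0.le]
  calc l * exp |x| < exp (-d) * exp |x| := by gcongr
    _ = exp (-d + |x|) := (exp_add _ _).symm
    _ ≤ exp (a * x + (1 + l) / (1 - l) * x ^ 2) := exp_le_exp.2 (by linarith)

/-- The per-step bound `exp (θ p + θ² (1 + l) / (4 (1 - l)))` on the moment generating function,
at `θ`, of the number of visits to a set of stationary probability `p`, for a chain whose spectrum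
on mean-zero functions lies below `l`. -/
noncomputable def mgfBound (l p θ : ℝ) : ℝ := exp (θ * p + θ ^ 2 / 4 * ((1 + l) / (1 - l)))

theorem mgfBound_pos (l p θ : ℝ) : 0 < mgfBound l p θ := exp_pos _

theorem mgfBound_eq (l p θ : ℝ) : mgfBound l p θ =
    exp (θ / 2) * exp ((2 * p - 1) * (θ / 2) + (1 + l) / (1 - l) * (θ / 2) ^ 2) := by
  rw [mgfBound, ← exp_add]
  ring_nf

variable {l p : ℝ}

theorem mul_exp_lt_mgfBound (hl : 0 ≤ l) (hl1 : l < 1) (hp : 0 ≤ p) (hp1 : p ≤ 1) (θ : ℝ) :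
    l * exp θ < mgfBound l p θ := by
  rw [mgfBound_eq]
  calc l * exp θ = exp (θ / 2) * (l * exp (θ / 2)) := by
        rw [mul_left_comm, ← exp_add, add_halves]
    _ ≤ exp (θ / 2) * (l * exp |θ / 2|) := by gcongr; exact le_abs_self _
    _ < _ := by gcongr; exact mul_exp_abs_lt hl hl1 (by linarith) (by linarith)

theorem lt_mgfBound (hl : 0 ≤ l) (hl1 : l < 1) (hp : 0 ≤ p) (hp1 : p ≤ 1) (θ : ℝ) :
    l < mgfBound l p θ := by
  rw [mgfBound_eq]
  calc l = exp (θ / 2) * (l * exp (-(θ / 2))) := by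
        rw [mul_left_comm, ← exp_add, add_neg_cancel, exp_zero, mul_one]
    _ ≤ exp (θ / 2) * (l * exp |θ / 2|) := by gcongr; exact neg_le_abs _
    _ < _ := by gcongr; exact mul_exp_abs_lt hl hl1 (by linarith) (by linarith)

theorem secular_mgfBound_le_one (hl : 0 ≤ l) (hl1 : l < 1) (hp : 0 ≤ p) (hp1 : p ≤ 1) (θ : ℝ) :
    (1 - l) * (p * (exp θ / (mgfBound l p θ - l * exp θ))
      + (1 - p) * (1 / (mgfBound l p θ - l))) ≤ 1 := by
  have hden : 0 < mgfBound l p θ - l * exp θ := sub_pos.2 (mul_exp_lt_mgfBound hl hl1 hp hp1 θ)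
  have hden' : 0 < mgfBound l p θ - l := sub_pos.2 (lt_mgfBound hl hl1 hp hp1 θ)
  have hl' : 0 < 1 - l := sub_pos.2 hl1
  have key := mul_cosh_add_mul_sinh_le (c := (1 + l) / (1 - l)) (a := 2 * p - 1) (x := θ / 2)
    ((one_le_div hl').2 (by linarith)) (by linarith) (by linarith)
  have hR := mgfBound_eq l p θ
  set y := (2 * p - 1) * (θ / 2) + (1 + l) / (1 - l) * (θ / 2) ^ 2
  set R := mgfBound l p θ
  have hexp : exp θ = exp (θ / 2) ^ 2 := by rw [sq, ← exp_add, add_halves]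
  have hquad : 0 ≤ R ^ 2 - R * (l * (1 + exp θ) + (1 - l) * (p * exp θ + (1 - p)))
      + l * exp θ := by
    rw [div_mul_eq_mul_div, div_mul_eq_mul_div, ← sub_nonneg] at key
    simp only [cosh_eq, sinh_eq, exp_neg] at key
    refine (mul_nonneg (mul_nonneg key hl'.le)
      (mul_pos (pow_pos (exp_pos (θ / 2)) 2) (exp_pos y)).le).trans_eq ?_
    rw [hexp, hR]
    field_simp
    ring
  rw [mul_div_assoc', mul_div_assoc', div_add_div _ _ hden.ne' hden'.ne', mul_div_assoc',
    div_le_one (mul_pos hden hden')]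
  linarith

theorem mul_exp_add_one_sub_le_mgfBound (hl : 0 ≤ l) (hl1 : l < 1) (hp : 0 ≤ p) (hp1 : p ≤ 1)
    (θ : ℝ) : p * exp θ + (1 - p) ≤ mgfBound l p θ := by
  have hzero : p * exp θ + (1 - p) ≤ mgfBound 0 p θ := by
    have h := secular_mgfBound_le_one le_rfl one_pos hp hp1 θ
    simp only [sub_zero, zero_mul, one_mul, mul_div_assoc', mul_one, ← add_div] at h
    rwa [div_le_one (mgfBound_pos 0 p θ)] at h
  refine hzero.trans (exp_le_exp.2 ?_)
  gcongr θ * p + θ ^ 2 / 4 * ?_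
  rw [add_zero, sub_zero, div_one, one_le_div (sub_pos.2 hl1)]
  linarith

end ScalarBounds

section SymmetricOperator

variable {H : Type*} [NormedAddCommGroup H] [InnerProductSpace ℝ H]

theorem norm_mem_spectrum_of_inner_nonneg [Nontrivial H] {S : H →L[ℝ] H}
    (hS : (S : H →ₗ[ℝ] H).IsSymmetric) (hpos : ∀ x, 0 ≤ inner ℝ (S x) x) :
    ‖S‖ ∈ spectrum ℝ S := by
  by_contra hmem
  obtain ⟨ε, hε, hle⟩ := S.rayleighQuotient_le_of_norm_mem_resolventSet (𝕜 := ℝ)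
    (by simpa [spectrum] using hmem)
  have habs (x : H) : |S.rayleighQuotient x| ≤ ‖S‖ - ε := by
    have hnonneg : 0 ≤ S.rayleighQuotient x := div_nonneg (hpos x) (sq_nonneg _)
    exact (abs_of_nonneg hnonneg).trans_le (hle x)
  have hnorm : ‖S‖ ≤ ‖S‖ - ε := (S.norm_eq_iSup_rayleighQuotient hS).trans_le (ciSup_le habs)
  linarith

theorem abs_inner_le_opNorm_mul_sq (T : H →L[ℝ] H) (x : H) :
    |inner ℝ (T x) x| ≤ ‖T‖ * ‖x‖ ^ 2 := calc
  |inner ℝ (T x) x| ≤ ‖T x‖ * ‖x‖ := abs_real_inner_le_norm _ _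
  _ ≤ ‖T‖ * ‖x‖ * ‖x‖ := by gcongr; exact T.le_opNorm x
  _ = ‖T‖ * ‖x‖ ^ 2 := by ring

theorem inner_le_sSup_spectrum [CompleteSpace H] {T : H →L[ℝ] H}
    (hT : (T : H →ₗ[ℝ] H).IsSymmetric) (x : H) :
    inner ℝ (T x) x ≤ sSup (spectrum ℝ T) * ‖x‖ ^ 2 := by
  rcases subsingleton_or_nontrivial H with hH | hH
  · simp [Subsingleton.elim x 0]
  -- The shift `S` by `‖T‖` is nonnegative, so its norm is the top of its spectrum.
  set S : H →L[ℝ] H := T + algebraMap ℝ (H →L[ℝ] H) ‖T‖ with hS_def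
  have hS_inner (y z : H) : inner ℝ (S y) z = inner ℝ (T y) z + ‖T‖ * inner ℝ y z := by
    simp [S, Algebra.algebraMap_eq_smul_one, inner_add_left, real_inner_smul_left]
  have hS : (S : H →ₗ[ℝ] H).IsSymmetric := fun y z => by
    have hTyz : inner ℝ (T y) z = inner ℝ (T z) y := (hT y z).trans (real_inner_comm _ _)
    rw [ContinuousLinearMap.coe_coe, hS_inner, hTyz, real_inner_comm z y, ← hS_inner,
      real_inner_comm]
  have hpos (y : H) : 0 ≤ inner ℝ (S y) y := by
    rw [hS_inner, real_inner_self_eq_norm_sq]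
    linarith [neg_le_of_abs_le (abs_inner_le_opNorm_mul_sq T y)]
  have hmem : ‖S‖ - ‖T‖ ∈ spectrum ℝ T :=
    (spectrum.add_mem_add_iff (R := ℝ) (s := ‖T‖)).1 <| by
      rw [sub_add_cancel, add_comm, ← hS_def]
      exact norm_mem_spectrum_of_inner_nonneg hS hpos
  have hsup : ‖S‖ - ‖T‖ ≤ sSup (spectrum ℝ T) :=
    le_csSup (spectrum.isCompact (𝕜 := ℝ) T).bddAbove hmem
  have hSx := (le_abs_self _).trans (abs_inner_le_opNorm_mul_sq S x)
  rw [hS_inner, real_inner_self_eq_norm_sq] at hSx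
  nlinarith [sq_nonneg ‖x‖]

theorem opNorm_le_of_abs_inner_le {T : H →L[ℝ] H} (hT : (T : H →ₗ[ℝ] H).IsSymmetric) {C : ℝ}
    (hC : 0 ≤ C) (h : ∀ x, |inner ℝ (T x) x| ≤ C * ‖x‖ ^ 2) : ‖T‖ ≤ C := by
  rw [T.norm_eq_iSup_rayleighQuotient hT]
  refine ciSup_le fun x => ?_
  rw [ContinuousLinearMap.rayleighQuotient, abs_div, abs_sq]
  exact div_le_of_le_mul₀ (sq_nonneg _) hC (h x)

/-- The compression of the operator `T` to the subspace `V`: apply `T`, then project back to `V`. -/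
noncomputable def compression (V : Submodule ℝ H) [V.HasOrthogonalProjection] (T : H →ₗ[ℝ] H) :
    V →ₗ[ℝ] V :=
  V.orthogonalProjectionOnto.toLinearMap ∘ₗ T ∘ₗ V.subtype

section Compression

variable (V : Submodule ℝ H) [V.HasOrthogonalProjection] (T : H →ₗ[ℝ] H)

theorem inner_compression (x y : V) : inner ℝ (compression V T x) y = inner ℝ (T x) (y : H) :=
  V.inner_orthogonalProjectionOnto_eq_of_mem_right y (T x)

variable {T} in
theorem isSymmetric_compression (hT : T.IsSymmetric) : (compression V T).IsSymmetric :=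
  fun x y => by
    rw [inner_compression, ← real_inner_comm x, inner_compression, real_inner_comm, hT]

variable {V} in
theorem coe_compression_pow {x : V} {n : ℕ} (hx : ∀ k ≤ n, (T ^ k) (x : H) ∈ V) :
    ((compression V T ^ n) x : H) = (T ^ n) (x : H) := by
  induction n with
  | zero => rfl
  | succ n ih =>
    have hmem := hx (n + 1) le_rfl
    rw [pow_succ', Module.End.mul_apply] at hmem ⊢
    rw [pow_succ', Module.End.mul_apply, ← ih fun k hk => hx k (hk.trans n.le_succ)] at *
    exact congrArg Subtype.val (V.orthogonalProjectionOnto_mem_subspace_eq_self ⟨_, hmem⟩)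

end Compression

open Polynomial in
theorem norm_aeval_apply_le_of_finiteDimensional [FiniteDimensional ℝ H] {T : H →ₗ[ℝ] H}
    (hT : T.IsSymmetric) {a b C : ℝ} (hlow : ∀ x, a * ‖x‖ ^ 2 ≤ inner ℝ (T x) x)
    (hup : ∀ x, inner ℝ (T x) x ≤ b * ‖x‖ ^ 2) (hC : 0 ≤ C) {p : ℝ[X]}
    (hp : ∀ μ ∈ Set.Icc a b, |p.eval μ| ≤ C) (x : H) : ‖aeval T p x‖ ≤ C * ‖x‖ := by
  let e := hT.eigenvectorBasis rfl
  let μ := hT.eigenvalues rfl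
  have heigen (i) : T (e i) = μ i • e i := hT.apply_eigenvectorBasis rfl i
  have hμ (i) : μ i ∈ Set.Icc a b := by
    have hinner : inner ℝ (T (e i)) (e i) = μ i := by
      simp [heigen, real_inner_smul_left]
    have h₁ := hlow (e i)
    have h₂ := hup (e i)
    simp only [hinner, e.norm_eq_one, one_pow, mul_one] at h₁ h₂
    exact ⟨h₁, h₂⟩
  have hcoord (i) : inner ℝ (e i) (aeval T p x) = p.eval (μ i) * inner ℝ (e i) x := by
    conv_lhs => rw [← e.sum_repr' x]
    simp only [map_sum, map_smul, Module.End.aeval_apply_of_mem_apply_eq_smul (heigen _), smul_smul]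
    rw [e.orthonormal.inner_right_fintype, mul_comm]
  rw [← sq_le_sq₀ (norm_nonneg _) (by positivity), mul_pow, ← e.sum_sq_norm_inner_right,
    ← e.sum_sq_norm_inner_right x, Finset.mul_sum]
  refine Finset.sum_le_sum fun i _ => ?_
  rw [hcoord, norm_mul, mul_pow]
  gcongr
  exact hp _ (hμ i)

open Polynomial in
theorem norm_aeval_apply_le {T : H →ₗ[ℝ] H}
    (hT : T.IsSymmetric) {a b C : ℝ} (hlow : ∀ x, a * ‖x‖ ^ 2 ≤ inner ℝ (T x) x)
    (hup : ∀ x, inner ℝ (T x) x ≤ b * ‖x‖ ^ 2) (hC : 0 ≤ C) {p : ℝ[X]}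
    (hp : ∀ μ ∈ Set.Icc a b, |p.eval μ| ≤ C) (x : H) : ‖aeval T p x‖ ≤ C * ‖x‖ := by
  -- Only the values `T ^ k x` with `k ≤ deg p` matter; they span a finite-dimensional space.
  let V : Submodule ℝ H :=
    Submodule.span ℝ (Set.range fun k : Fin (p.natDegree + 1) => (T ^ (k : ℕ)) x)
  have : FiniteDimensional ℝ V := FiniteDimensional.span_of_finite ℝ (Set.finite_range _)
  have hmem (k : ℕ) (hk : k ≤ p.natDegree) : (T ^ k) x ∈ V :=
    Submodule.subset_span ⟨⟨k, Nat.lt_succ_of_le hk⟩, rfl⟩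
  let x' : V := ⟨x, hmem 0 (Nat.zero_le _)⟩
  have haeval : (aeval (compression V T) p x' : H) = aeval T p x := by
    simp only [aeval_eq_sum_range, LinearMap.sum_apply, LinearMap.smul_apply,
      Submodule.coe_sum, Submodule.coe_smul]
    refine Finset.sum_congr rfl fun k hk => ?_
    rw [coe_compression_pow T fun j hj =>
      hmem j (hj.trans (Nat.lt_succ_iff.1 (Finset.mem_range.1 hk)))]
  rw [← haeval]
  exact norm_aeval_apply_le_of_finiteDimensional (isSymmetric_compression V hT)
    (fun y => by rw [inner_compression]; exact hlow y)
    (fun y => by rw [inner_compression]; exact hup y) hC hp x'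

theorem abs_geom_sum_le {l μ : ℝ} (hμ : -1 ≤ μ) (hμl : μ ≤ l) (hl : 0 ≤ l) (n : ℕ) :
    |∑ k ∈ Finset.range n, μ ^ k| ≤ ∑ k ∈ Finset.range n, l ^ k := by
  rcases le_total 0 μ with hμ0 | hμ0
  · rw [abs_of_nonneg (Finset.sum_nonneg fun k _ => pow_nonneg hμ0 k)]
    gcongr
  · rcases n with _ | n
    · simp
    have hone : (1 : ℝ) ≤ ∑ k ∈ Finset.range (n + 1), l ^ k := by
      rw [Finset.sum_range_succ', pow_zero, le_add_iff_nonneg_left]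
      exact Finset.sum_nonneg fun k _ => pow_nonneg hl (k + 1)
    refine le_trans ?_ hone
    have hgeom : (∑ k ∈ Finset.range (n + 1), μ ^ k) * (1 - μ) = 1 - μ ^ (n + 1) :=
      geom_sum_mul_neg μ (n + 1)
    have hpow : |μ ^ (n + 1)| ≤ -μ := by
      rw [abs_pow, abs_of_nonpos hμ0, pow_succ]
      exact mul_le_of_le_one_left (neg_nonneg.2 hμ0) (pow_le_one₀ (neg_nonneg.2 hμ0) (by linarith))
    rw [abs_le] at hpow ⊢
    constructor <;> nlinarith

theorem norm_sum_pow_apply_le {T : H →ₗ[ℝ] H} (hT : T.IsSymmetric)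
    {l : ℝ} (hl : 0 ≤ l) (hlow : ∀ x, -‖x‖ ^ 2 ≤ inner ℝ (T x) x)
    (hup : ∀ x, inner ℝ (T x) x ≤ l * ‖x‖ ^ 2) (n : ℕ) (x : H) :
    ‖∑ k ∈ Finset.range n, (T ^ k) x‖ ≤ (∑ k ∈ Finset.range n, l ^ k) * ‖x‖ := by
  have h := norm_aeval_apply_le hT (a := -1) (p := ∑ k ∈ Finset.range n, Polynomial.X ^ k)
    (fun x => by simpa using hlow x) hup (Finset.sum_nonneg fun k _ => pow_nonneg hl k)
    (fun μ hμ => by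
      simpa [Polynomial.eval_finsetSum] using abs_geom_sum_le hμ.1 hμ.2 hl n) x
  simpa using h

theorem inner_le_of_unit_fixed {T : H →ₗ[ℝ] H} (hT : T.IsSymmetric) {e : H} (he : ‖e‖ = 1)
    (hTe : T e = e) {l : ℝ} (hup : ∀ y, inner ℝ e y = 0 → inner ℝ (T y) y ≤ l * ‖y‖ ^ 2) (x : H) :
    inner ℝ (T x) x ≤ l * ‖x‖ ^ 2 + (1 - l) * inner ℝ e x ^ 2 := by
  have hee : inner ℝ e e = 1 := by rw [real_inner_self_eq_norm_sq, he, one_pow]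
  obtain ⟨y, m, hy, rfl⟩ : ∃ (y : H) (m : ℝ), inner ℝ e y = 0 ∧ x = y + m • e :=
    ⟨x - inner ℝ e x • e, inner ℝ e x, by simp [inner_sub_right, inner_smul_right, he],
      (sub_add_cancel _ _).symm⟩
  have hye : inner ℝ y e = 0 := by rw [real_inner_comm, hy]
  have hTye : inner ℝ (T y) e = 0 := by rw [hT, hTe, hye]
  have hform : inner ℝ (T (y + m • e)) (y + m • e) = inner ℝ (T y) y + m ^ 2 := by
    simp only [map_add, map_smul, hTe, inner_add_left, inner_add_right, real_inner_smul_left,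
      real_inner_smul_right, hy, hTye, hee]
    ring
  have hnorm : ‖y + m • e‖ ^ 2 = ‖y‖ ^ 2 + m ^ 2 := by
    simp only [← real_inner_self_eq_norm_sq, inner_add_left, inner_add_right, real_inner_smul_left,
      real_inner_smul_right, hy, hye, hee]
    ring
  have hmean : inner ℝ e (y + m • e) = m := by
    simp [inner_add_right, inner_smul_right, hy, he]
  rw [hform, hnorm, hmean]
  linarith [hup y hy]

theorem norm_sub_inner_smul_le {e : H} (he : ‖e‖ = 1) (x : H) : ‖x - inner ℝ e x • e‖ ≤ ‖x‖ := by
  refine le_of_sq_le_sq ?_ (norm_nonneg x)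
  rw [norm_sub_sq_real, real_inner_smul_right, norm_smul, he, mul_one, Real.norm_eq_abs, sq_abs,
    real_inner_comm]
  nlinarith [sq_nonneg (inner ℝ e x)]

theorem inner_pow_apply_sub_inner {T : H →ₗ[ℝ] H} (hT : T.IsSymmetric) {e h : H} (he : ‖e‖ = 1)
    (hTe : T e = e) (hh : inner ℝ e h = 1) (x : H) (k : ℕ) :
    inner ℝ h ((T ^ k) x) - inner ℝ e x = inner ℝ (h - e) ((T ^ k) (x - inner ℝ e x • e)) := by
  have hfix : (T ^ k) e = e := by rw [Module.End.pow_apply, Function.iterate_fixed hTe]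
  have hex : inner ℝ e ((T ^ k) x) = inner ℝ e x := by rw [← hT.pow k, hfix]
  have hee : inner ℝ (h - e) e = 0 := by
    rw [inner_sub_left, real_inner_comm, hh, real_inner_self_eq_norm_sq, he]
    norm_num
  rw [map_sub, map_smul, hfix, inner_sub_right, real_inner_smul_right, hee, mul_zero, sub_zero,
    inner_sub_left, hex]

theorem norm_pow_apply_le {E : Type*} [SeminormedAddCommGroup E] [NormedSpace ℝ E] (T : E →L[ℝ] E)
    (k : ℕ) (x : E) : ‖(T ^ k) x‖ ≤ ‖T‖ ^ k * ‖x‖ := by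
  induction k with
  | zero => simp
  | succ k ih =>
    rw [pow_succ', pow_succ', mul_assoc]
    exact T.le_opNorm_of_le ih

end SymmetricOperator

section MarkovOperatorProperties

variable {α : Type*} [MeasurableSpace α] {K : Kernel α α} {π : Measure α} [IsMarkovKernel K]
  [IsProbabilityMeasure π]

theorem compProd_map_swap (hK : K.IsReversible π) : (π ⊗ₘ K).map Prod.swap = π ⊗ₘ K := by
  refine Measure.ext_prod fun {A B} hA hB => ?_
  rw [Measure.map_apply measurable_swap (hA.prod hB), Set.preimage_swap_prod,
    Measure.compProd_apply_prod hB hA, Measure.compProd_apply_prod hA hB]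
  exact hK hB hA

theorem measurePreserving_fst_compProd : MeasurePreserving Prod.fst (π ⊗ₘ K) π :=
  ⟨measurable_fst, Measure.fst_compProd π K⟩

theorem measurePreserving_snd_compProd (hK : K.Invariant π) :
    MeasurePreserving Prod.snd (π ⊗ₘ K) π :=
  ⟨measurable_snd, by rw [← Measure.snd, Measure.snd_compProd, hK.def]⟩

theorem inner_markovOperator (hK : K.Invariant π) (f g : Lp ℝ 2 π) :
    inner ℝ (markovOperator K π hK f) g = ∫ z, f z.2 * g z.1 ∂(π ⊗ₘ K) := by
  have hint : Integrable (fun z : α × α => f z.2 * g z.1) (π ⊗ₘ K) :=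
    ((Lp.memLp f).comp_measurePreserving (measurePreserving_snd_compProd hK)).integrable_mul
      ((Lp.memLp g).comp_measurePreserving measurePreserving_fst_compProd)
  rw [L2.inner_def, Measure.integral_compProd hint]
  refine integral_congr_ae ?_
  filter_upwards [markovOperator_coeFn hK f] with x hx
  rw [integral_mul_const, hx, real_inner_eq_re_inner, RCLike.inner_apply]
  simp [mul_comm]

theorem isSymmetric_markovOperator (hK : K.IsReversible π) :
    (markovOperator K π hK.invariant : Lp ℝ 2 π →ₗ[ℝ] Lp ℝ 2 π).IsSymmetric := fun f g => by
  have hswap : MeasurePreserving (MeasurableEquiv.prodComm (α := α) (β := α)) (π ⊗ₘ K) (π ⊗ₘ K) :=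
    ⟨measurable_swap, compProd_map_swap hK⟩
  rw [ContinuousLinearMap.coe_coe, real_inner_comm _ f, inner_markovOperator, inner_markovOperator,
    ← hswap.integral_comp']
  exact integral_congr_ae (.of_forall fun z => mul_comm _ _)

theorem abs_inner_markovOperator_le (hK : K.Invariant π) (f g : Lp ℝ 2 π) :
    |inner ℝ (markovOperator K π hK f) g| ≤ inner ℝ (markovOperator K π hK |f|) |g| := by
  rw [inner_markovOperator, inner_markovOperator]
  refine abs_integral_le_integral_abs.trans_eq (integral_congr_ae ?_)
  filter_upwards [(measurePreserving_snd_compProd hK).quasiMeasurePreserving.ae (Lp.coeFn_abs f),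
    measurePreserving_fst_compProd.quasiMeasurePreserving.ae (Lp.coeFn_abs g)] with z hf hg
  rw [hf, hg, abs_mul]

theorem norm_markovOperator_le (hK : K.Invariant π) : ‖markovOperator K π hK‖ ≤ 1 :=
  LinearMap.mkContinuous_norm_le _ zero_le_one _

theorem inner_const_one (f : Lp ℝ 2 π) : inner ℝ (Lp.const 2 π (1 : ℝ)) f = ∫ x, f x ∂π := by
  rw [← indicatorConstLp_univ, L2.inner_indicatorConstLp_one, Measure.restrict_univ]

theorem norm_const_one : ‖Lp.const 2 π (1 : ℝ)‖ = 1 := by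
  simp [Lp.norm_const]

theorem markovOperator_const_one (hK : K.Invariant π) :
    markovOperator K π hK (Lp.const 2 π 1) = Lp.const 2 π 1 := by
  refine Lp.ext ?_
  filter_upwards [markovOperator_coeFn hK (Lp.const 2 π 1),
    kernelMean_congr hK (Lp.coeFn_const 2 π (1 : ℝ)), Lp.coeFn_const 2 π (1 : ℝ)]
    with x hx hmean hconst
  rw [hx, hmean, hconst]
  simp

theorem mem_L2Zero_iff {f : Lp ℝ 2 π} : f ∈ L2Zero π ↔ inner ℝ (Lp.const 2 π (1 : ℝ)) f = 0 := by
  rw [inner_const_one]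
  rfl

instance : CompleteSpace (L2Zero π) := by
  have : L2Zero π = (ℝ ∙ Lp.const 2 π (1 : ℝ))ᗮ := by
    ext f
    rw [mem_L2Zero_iff, Submodule.mem_orthogonal_singleton_iff_inner_right]
  rw [this]
  infer_instance

theorem specSup₀_nonneg (hK : K.IsReversible π) : 0 ≤ specSup₀ K π hK := le_max_left _ _

theorem specSup₀_lt_one {hK : K.IsReversible π} (hVB : VarianceBounding K π hK) :
    specSup₀ K π hK < 1 := max_lt one_pos hVB

theorem isSymmetric_markovOperatorZero (hK : K.IsReversible π) :
    (markovOperatorZero K π hK.invariant : L2Zero π →ₗ[ℝ] L2Zero π).IsSymmetric :=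
  fun f g => isSymmetric_markovOperator hK f g

theorem inner_markovOperatorZero_le (hK : K.IsReversible π) (f : L2Zero π) :
    inner ℝ (markovOperatorZero K π hK.invariant f) f ≤ specSup₀ K π hK * ‖f‖ ^ 2 :=
  (inner_le_sSup_spectrum (isSymmetric_markovOperatorZero hK) f).trans <| by
    gcongr
    exact le_max_right _ _

theorem neg_sq_norm_le_inner_markovOperatorZero (hK : K.Invariant π) (f : L2Zero π) :
    -‖f‖ ^ 2 ≤ inner ℝ (markovOperatorZero K π hK f) f := by
  refine neg_le_of_abs_le ((abs_inner_le_opNorm_mul_sq (markovOperator K π hK) f).trans ?_)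
  exact mul_le_of_le_one_left (sq_nonneg _) (norm_markovOperator_le hK)

theorem inner_markovOperator_self_le (hK : K.IsReversible π) (f : Lp ℝ 2 π) :
    inner ℝ (markovOperator K π hK.invariant f) f
      ≤ specSup₀ K π hK * ‖f‖ ^ 2 + (1 - specSup₀ K π hK) * (∫ x, f x ∂π) ^ 2 := by
  rw [← inner_const_one]
  exact inner_le_of_unit_fixed (isSymmetric_markovOperator hK) norm_const_one
    (markovOperator_const_one hK.invariant)
    (fun g hg => inner_markovOperatorZero_le hK ⟨g, mem_L2Zero_iff.2 hg⟩) f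

theorem coe_markovOperatorZero_pow (hK : K.Invariant π) (k : ℕ) (f : L2Zero π) :
    (((markovOperatorZero K π hK : L2Zero π →ₗ[ℝ] L2Zero π) ^ k) f : Lp ℝ 2 π)
      = (markovOperator K π hK ^ k) f := by
  induction k with
  | zero => rfl
  | succ k ih =>
    rw [pow_succ', Module.End.mul_apply, pow_succ', mul_apply_eq_comp, ← ih]
    rfl

theorem norm_sum_markovOperator_pow_le (hK : K.IsReversible π) (n : ℕ) {f : Lp ℝ 2 π}
    (hf : f ∈ L2Zero π) :
    ‖∑ k ∈ Finset.range n, (markovOperator K π hK.invariant ^ k) f‖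
      ≤ (∑ k ∈ Finset.range n, specSup₀ K π hK ^ k) * ‖f‖ := by
  have h := norm_sum_pow_apply_le (isSymmetric_markovOperatorZero hK) (specSup₀_nonneg hK)
    (neg_sq_norm_le_inner_markovOperatorZero hK.invariant) (inner_markovOperatorZero_le hK) n
    ⟨f, hf⟩
  simpa only [Submodule.coe_norm, Submodule.coe_sum, coe_markovOperatorZero_pow] using h

end MarkovOperatorProperties

section MulOperator

variable {α : Type*} [MeasurableSpace α] {π : Measure α} {w : α → ℝ}

/-- Multiplication by a bounded function `w`, as an operator on `L₂(π)`. -/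
noncomputable def mulOperator (hw : MemLp w ∞ π) : Lp ℝ 2 π →L[ℝ] Lp ℝ 2 π :=
  (ContinuousLinearMap.mul ℝ ℝ).holderL π ∞ 2 2 hw.toLp

theorem mulOperator_coeFn (hw : MemLp w ∞ π) (f : Lp ℝ 2 π) :
    mulOperator hw f =ᵐ[π] fun x => w x * f x := by
  filter_upwards [(ContinuousLinearMap.mul ℝ ℝ).coeFn_holder (r := 2) hw.toLp f,
    hw.coeFn_toLp] with x hx hwx
  rw [← hwx]
  exact hx

theorem mulOperator_const_one (f : Lp ℝ 2 π) :
    mulOperator (memLp_top_const (1 : ℝ)) f = f := by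
  refine Lp.ext ?_
  filter_upwards [mulOperator_coeFn (memLp_top_const (1 : ℝ)) f] with x hx
  rw [hx, one_mul]

theorem isSymmetric_mulOperator (hw : MemLp w ∞ π) :
    (mulOperator hw : Lp ℝ 2 π →ₗ[ℝ] Lp ℝ 2 π).IsSymmetric := fun f g => by
  rw [ContinuousLinearMap.coe_coe, L2.inner_def, L2.inner_def]
  refine integral_congr_ae ?_
  filter_upwards [mulOperator_coeFn hw f, mulOperator_coeFn hw g] with x hf hg
  simp only [hf, hg, RCLike.inner_apply, conj_trivial]
  ring

theorem norm_sq_eq_integral_sq (f : Lp ℝ 2 π) : ‖f‖ ^ 2 = ∫ x, f x ^ 2 ∂π := by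
  rw [← real_inner_self_eq_norm_sq, L2.inner_def]
  simp only [real_inner_self_eq_norm_sq, Real.norm_eq_abs, sq_abs]

theorem inner_toLp {f g : α → ℝ} (hf : MemLp f 2 π) (hg : MemLp g 2 π) :
    inner ℝ (hf.toLp f) (hg.toLp g) = ∫ x, f x * g x ∂π := by
  rw [L2.inner_def]
  refine integral_congr_ae ?_
  filter_upwards [hf.coeFn_toLp, hg.coeFn_toLp] with x hfx hgx
  simp [hfx, hgx, mul_comm]

theorem sq_integral_mul_le {f g : α → ℝ} (hf : MemLp f 2 π) (hg : MemLp g 2 π) :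
    (∫ x, f x * g x ∂π) ^ 2 ≤ (∫ x, f x ^ 2 ∂π) * ∫ x, g x ^ 2 ∂π := by
  simpa only [inner_toLp, ← sq] using real_inner_mul_inner_self_le (hf.toLp f) (hg.toLp g)

theorem sq_integral_abs_mul_le {f W : α → ℝ} (hw : AEStronglyMeasurable w π)
    (hf : AEStronglyMeasurable f π) (hW : AEStronglyMeasurable W π) (hpos : ∀ x, 0 < W x)
    (hwW : Integrable (fun x => w x ^ 2 / W x) π) (hWf : Integrable (fun x => W x * f x ^ 2) π) :
    (∫ x, |w x * f x| ∂π) ^ 2 ≤ (∫ x, w x ^ 2 / W x ∂π) * ∫ x, W x * f x ^ 2 ∂π := by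
  have hsqrt : AEStronglyMeasurable (fun x => √(W x)) π := by fun_prop
  let u (x : α) : ℝ := |w x| / √(W x)
  let v (x : α) : ℝ := √(W x) * |f x|
  have hu_sq (x : α) : u x ^ 2 = w x ^ 2 / W x := by
    rw [div_pow, sq_abs, Real.sq_sqrt (hpos x).le]
  have hv_sq (x : α) : v x ^ 2 = W x * f x ^ 2 := by
    rw [mul_pow, sq_abs, Real.sq_sqrt (hpos x).le]
  have huv (x : α) : u x * v x = |w x * f x| := by
    rw [abs_mul, ← mul_assoc, div_mul_cancel₀ _ (Real.sqrt_pos.2 (hpos x)).ne']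
  have hu_meas : AEStronglyMeasurable u π := hw.norm.div₀ hsqrt
  have hv_meas : AEStronglyMeasurable v π := hsqrt.mul hf.norm
  have hu : MemLp u 2 π :=
    (memLp_two_iff_integrable_sq hu_meas).2 (by simpa only [hu_sq] using hwW)
  have hv : MemLp v 2 π :=
    (memLp_two_iff_integrable_sq hv_meas).2 (by simpa only [hv_sq] using hWf)
  simpa only [hu_sq, hv_sq, huv] using sq_integral_mul_le hu hv

theorem mul_norm_sq_add_le (hw : MemLp w ∞ π) {l R : ℝ} (hl : l ≤ 1)
    (hR : ∀ x, l * w x ^ 2 < R) (hint : Integrable (fun x => w x ^ 2 / (R - l * w x ^ 2)) π)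
    (hone : (1 - l) * ∫ x, w x ^ 2 / (R - l * w x ^ 2) ∂π ≤ 1) (f : Lp ℝ 2 π) :
    l * ‖mulOperator hw f‖ ^ 2 + (1 - l) * (∫ x, |mulOperator hw f| x ∂π) ^ 2 ≤ R * ‖f‖ ^ 2 := by
  have hpos (x : α) : 0 < R - l * w x ^ 2 := sub_pos.2 (hR x)
  have hwf := mulOperator_coeFn hw f
  set g := mulOperator hw f
  have habs : ∫ x, |g| x ∂π = ∫ x, |w x * f x| ∂π := integral_congr_ae <| by
    filter_upwards [hwf, Lp.coeFn_abs g] with x hx hgx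
    rw [hgx, hx]
  have hsq : (fun x => (R - l * w x ^ 2) * f x ^ 2) =ᵐ[π] fun x => R * f x ^ 2 - l * g x ^ 2 := by
    filter_upwards [hwf] with x hx
    rw [hx]
    ring
  have hf_int : Integrable (fun x => R * f x ^ 2) π := (Lp.memLp f).integrable_sq.const_mul R
  have hg_int : Integrable (fun x => l * g x ^ 2) π := (Lp.memLp g).integrable_sq.const_mul l
  have hsq_int : ∫ x, (R - l * w x ^ 2) * f x ^ 2 ∂π = R * ‖f‖ ^ 2 - l * ‖g‖ ^ 2 := by
    rw [integral_congr_ae hsq, integral_sub hf_int hg_int, integral_const_mul,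
      integral_const_mul, norm_sq_eq_integral_sq, norm_sq_eq_integral_sq]
  have hsq_nonneg : 0 ≤ R * ‖f‖ ^ 2 - l * ‖g‖ ^ 2 :=
    hsq_int ▸ integral_nonneg fun x => mul_nonneg (hpos x).le (sq_nonneg _)
  have hW : AEStronglyMeasurable (fun x => R - l * w x ^ 2) π :=
    aestronglyMeasurable_const.sub ((hw.1.pow 2).const_mul l)
  have hcs := sq_integral_abs_mul_le hw.1 (Lp.aestronglyMeasurable f) hW hpos hint
    ((hf_int.sub hg_int).congr hsq.symm)
  rw [← habs, hsq_int] at hcs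
  have hmul := (mul_le_mul_of_nonneg_left hcs (sub_nonneg.2 hl)).trans_eq (mul_assoc _ _ _).symm
  linarith [mul_le_of_le_one_left hsq_nonneg hone]

end MulOperator

section TiltedOperator

variable {α : Type*} [MeasurableSpace α] {K : Kernel α α} {π : Measure α} [IsMarkovKernel K]
  [IsProbabilityMeasure π] {w : α → ℝ}

/-- The Markov operator conjugated by the weight `w`, that is `f ↦ w · P (w · f)`. Its powers
describe the expectation of `∏ w(Xᵢ)²` along the chain `(Xᵢ)` with kernel `K`. -/
noncomputable def tiltedOperator (hK : K.Invariant π) (hw : MemLp w ∞ π) :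
    Lp ℝ 2 π →L[ℝ] Lp ℝ 2 π :=
  mulOperator hw ∘L markovOperator K π hK ∘L mulOperator hw

theorem inner_tiltedOperator (hK : K.Invariant π) (hw : MemLp w ∞ π) (f g : Lp ℝ 2 π) :
    inner ℝ (tiltedOperator hK hw f) g
      = inner ℝ (markovOperator K π hK (mulOperator hw f)) (mulOperator hw g) :=
  isSymmetric_mulOperator hw _ _

theorem isSymmetric_tiltedOperator (hK : K.IsReversible π) (hw : MemLp w ∞ π) :
    (tiltedOperator hK.invariant hw : Lp ℝ 2 π →ₗ[ℝ] Lp ℝ 2 π).IsSymmetric := fun f g => by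
  rw [ContinuousLinearMap.coe_coe, inner_tiltedOperator,
    ← real_inner_comm f, inner_tiltedOperator]
  exact (isSymmetric_markovOperator hK _ _).trans (real_inner_comm _ _)

theorem norm_tiltedOperator_le (hK : K.IsReversible π) (hVB : VarianceBounding K π hK)
    (hw : MemLp w ∞ π) {R : ℝ} (hR : ∀ x, specSup₀ K π hK * w x ^ 2 < R)
    (hint : Integrable (fun x => w x ^ 2 / (R - specSup₀ K π hK * w x ^ 2)) π)
    (hone : (1 - specSup₀ K π hK) * ∫ x, w x ^ 2 / (R - specSup₀ K π hK * w x ^ 2) ∂π ≤ 1) :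
    ‖tiltedOperator hK.invariant hw‖ ≤ R := by
  have hR0 : 0 ≤ R := by
    obtain ⟨x⟩ := π.nonempty_of_neZero
    exact (mul_nonneg (specSup₀_nonneg hK) (sq_nonneg (w x))).trans (hR x).le
  refine opNorm_le_of_abs_inner_le (isSymmetric_tiltedOperator hK hw) hR0 fun f => ?_
  rw [inner_tiltedOperator]
  refine (abs_inner_markovOperator_le hK.invariant _ _).trans
    ((inner_markovOperator_self_le hK _).trans ?_)
  rw [norm_abs_eq_norm]
  exact mul_norm_sq_add_le hw (specSup₀_lt_one hVB).le hR hint hone f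

end TiltedOperator

section VisitWeight

variable {α : Type*}

/-- The square root `exp (θ / 2 · 1_B)` of the factor by which a visit to `B` multiplies the
exponential of `θ` times the number of visits. -/
noncomputable def visitWeight (θ : ℝ) (B : Set α) (x : α) : ℝ :=
  Real.exp (θ / 2 * B.indicator (fun _ => 1) x)

theorem visitWeight_sq (θ : ℝ) (B : Set α) (x : α) :
    visitWeight θ B x ^ 2 = Real.exp (θ * B.indicator (fun _ => 1) x) := by
  rw [visitWeight, ← Real.exp_nat_mul]
  ring_nf

theorem comp_indicator_one_eq (B : Set α) (F : ℝ → ℝ) :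
    (fun x => F (B.indicator (fun _ => 1) x))
      = B.indicator (fun _ => F 1) + Bᶜ.indicator (fun _ => F 0) := by
  ext x
  by_cases hx : x ∈ B <;> simp [hx]

variable [MeasurableSpace α] {π : Measure α} {B : Set α}

theorem measurable_visitWeight (θ : ℝ) (hB : MeasurableSet B) : Measurable (visitWeight θ B) :=
  Real.measurable_exp.comp ((measurable_const.indicator hB).const_mul _)

theorem memLp_top_visitWeight (θ : ℝ) (hB : MeasurableSet B) : MemLp (visitWeight θ B) ∞ π := by
  refine memLp_top_of_bound (measurable_visitWeight θ hB).aestronglyMeasurable (Real.exp |θ / 2|)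
    (.of_forall fun x => ?_)
  rw [visitWeight, Real.norm_eq_abs, Real.abs_exp, Real.exp_le_exp]
  by_cases hx : x ∈ B <;> simp [hx, le_abs_self]

variable [IsProbabilityMeasure π]

theorem integrable_comp_indicator_one (hB : MeasurableSet B) (F : ℝ → ℝ) :
    Integrable (fun x => F (B.indicator (fun _ => 1) x)) π := by
  rw [comp_indicator_one_eq]
  exact ((integrable_const _).indicator hB).add ((integrable_const _).indicator hB.compl)

theorem integral_comp_indicator_one (hB : MeasurableSet B) (F : ℝ → ℝ) :
    ∫ x, F (B.indicator (fun _ => 1) x) ∂π = π.real B * F 1 + (1 - π.real B) * F 0 := by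
  rw [comp_indicator_one_eq, integral_add' ((integrable_const _).indicator hB)
    ((integrable_const _).indicator hB.compl), integral_indicator_const _ hB,
    integral_indicator_const _ hB.compl, probReal_compl_eq_one_sub hB, smul_eq_mul, smul_eq_mul]

theorem norm_sq_mulOperator_visitWeight_le (hB : MeasurableSet B) {l : ℝ} (hl : 0 ≤ l)
    (hl1 : l < 1) (θ : ℝ) :
    ‖mulOperator (memLp_top_visitWeight θ hB) (Lp.const 2 π 1)‖ ^ 2
      ≤ mgfBound l (π.real B) θ := by
  have hsq : ∫ x, mulOperator (memLp_top_visitWeight θ hB) (Lp.const 2 π 1) x ^ 2 ∂π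
      = ∫ x, Real.exp (θ * B.indicator (fun _ => 1) x) ∂π := integral_congr_ae <| by
    filter_upwards [mulOperator_coeFn (memLp_top_visitWeight θ hB) (Lp.const 2 π 1),
      Lp.coeFn_const 2 π (1 : ℝ)] with x hx hone
    rw [hx, hone, Function.const_apply, mul_one, visitWeight_sq]
  rw [norm_sq_eq_integral_sq, hsq, integral_comp_indicator_one hB fun t => Real.exp (θ * t)]
  simpa using mul_exp_add_one_sub_le_mgfBound hl hl1 measureReal_nonneg measureReal_le_one θ

variable {K : Kernel α α} [IsMarkovKernel K]

theorem norm_tiltedOperator_visitWeight_le (hK : K.IsReversible π)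
    (hVB : VarianceBounding K π hK) (hB : MeasurableSet B) (θ : ℝ) :
    ‖tiltedOperator hK.invariant (memLp_top_visitWeight θ hB)‖
      ≤ mgfBound (specSup₀ K π hK) (π.real B) θ := by
  have hl := specSup₀_nonneg hK
  have hl1 := specSup₀_lt_one hVB
  have hp : 0 ≤ π.real B := measureReal_nonneg
  have hp1 : π.real B ≤ 1 := measureReal_le_one
  let F (t : ℝ) : ℝ := Real.exp (θ * t) / (mgfBound (specSup₀ K π hK) (π.real B) θ
    - specSup₀ K π hK * Real.exp (θ * t))
  refine norm_tiltedOperator_le hK hVB _ (fun x => ?_) ?_ ?_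
  · rw [visitWeight_sq]
    by_cases hx : x ∈ B
    · simpa [hx] using mul_exp_lt_mgfBound hl hl1 hp hp1 θ
    · simpa [hx] using lt_mgfBound hl hl1 hp hp1 θ
  · simpa only [visitWeight_sq] using integrable_comp_indicator_one hB F
  · simp only [visitWeight_sq]
    rw [integral_comp_indicator_one hB F]
    simpa [F] using secular_mgfBound_le_one hl hl1 hp hp1 θ

end VisitWeight

section ChainState

variable {β γ : Type*} (φ : β → γ → β)

/-- The state `φ_i(x; v_1, …, v_i)` of the chain started in `x` and driven by `v_1, …, v_k`, for
`i ≤ k`. The driver `v_j` is the entry of `v` with index `j - 1`. -/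
def chainState (x : β) {k : ℕ} (v : Fin k → γ) (i : Fin (k + 1)) : β :=
  iterUpdate φ i x fun j => v (Fin.castLE (Nat.le_of_lt_succ i.isLt) j)

theorem chainState_zero (x : β) {k : ℕ} (v : Fin k → γ) : chainState φ x v 0 = x := rfl

theorem chainState_castSucc (x : β) {k : ℕ} (v : Fin (k + 1) → γ) (i : Fin (k + 1)) :
    chainState φ x v i.castSucc = chainState φ x (Fin.init v) i := rfl

variable {φ} in
theorem measurable_chainState [MeasurableSpace β] [MeasurableSpace γ]
    (hφ : Measurable (Function.uncurry φ)) (k : ℕ) (i : Fin (k + 1)) :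
    Measurable fun z : β × (Fin k → γ) => chainState φ z.1 z.2 i := by
  induction k with
  | zero =>
    rw [Fin.fin_one_eq_zero i]
    exact measurable_fst
  | succ k ih =>
    have hinit : Measurable fun z : β × (Fin (k + 1) → γ) => (z.1, Fin.init z.2) :=
      measurable_fst.prodMk <| measurable_pi_lambda _ fun j =>
        (measurable_pi_apply j.castSucc).comp measurable_snd
    cases i using Fin.lastCases with
    | cast i => exact (ih i).comp hinit
    | last =>
      exact hφ.comp (((ih (Fin.last k)).comp hinit).prodMk
        ((measurable_pi_apply (Fin.last k)).comp measurable_snd))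

end ChainState

section StationaryChain

variable {γ : Type*} [MeasureSpace γ] [IsProbabilityMeasure (volume : Measure γ)]

theorem measurePreserving_init_last (k : ℕ) :
    MeasurePreserving (fun v : Fin (k + 1) → γ => (Fin.init v, v (Fin.last k)))
      volume (volume.prod volume) := by
  have h := Measure.measurePreserving_swap.comp
    (volume_preserving_piFinSuccAbove (fun _ => γ) (Fin.last k))
  simp only [MeasurableEquiv.piFinSuccAbove_apply, Fin.insertNthEquiv_last] at h
  exact h

theorem measurePreserving_zero_tail (k : ℕ) :
    MeasurePreserving (fun v : Fin (k + 1) → γ => (v 0, Fin.tail v))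
      volume (volume.prod volume) :=
  volume_preserving_piFinSuccAbove (fun _ => γ) 0

variable {α : Type*} [MeasurableSpace α] {π : Measure α} [IsProbabilityMeasure π]

theorem measurePreserving_prod_init_last (k : ℕ) :
    MeasurePreserving (fun z : α × (Fin (k + 1) → γ) => ((z.1, Fin.init z.2), z.2 (Fin.last k)))
      (π.prod volume) ((π.prod volume).prod volume) :=
  (measurePreserving_prodAssoc π volume volume).symm.comp
    ((MeasurePreserving.id π).prod (measurePreserving_init_last k))

end StationaryChain

section FeynmanKac

variable {α : Type*} [MeasurableSpace α] {K : Kernel α α} {π : Measure α} {s : ℕ}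
  {φ : α → Cube s → α}

theorem IsUpdateFunction.map_eq (hφ : IsUpdateFunction K φ) (x : α) :
    (volume : Measure (Cube s)).map (φ x) = K x := by
  ext A hA
  rw [Measure.map_apply hφ.measurable.of_uncurry_left hA, hφ.kernel_eq x A hA]
  rfl

theorem IsUpdateFunction.measurePreserving (hφ : IsUpdateFunction K φ) (hK : K.Invariant π) :
    MeasurePreserving (Function.uncurry φ) (π.prod volume) π := by
  refine ⟨hφ.measurable, ?_⟩
  ext A hA
  rw [Measure.map_apply hφ.measurable hA, Measure.prod_apply (hφ.measurable hA)]
  nth_rw 2 [← hK.def]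
  rw [Measure.bind_apply hA K.aemeasurable]
  exact lintegral_congr fun x => (hφ.kernel_eq x A hA).symm

variable [IsProbabilityMeasure π]

theorem measurePreserving_chainState (hφ : IsUpdateFunction K φ) (hK : K.Invariant π) (k : ℕ)
    (i : Fin (k + 1)) :
    MeasurePreserving (fun z : α × (Fin k → Cube s) => chainState φ z.1 z.2 i)
      (π.prod volume) π := by
  induction k with
  | zero =>
    rw [Fin.fin_one_eq_zero i]
    exact measurePreserving_fst
  | succ k ih =>
    cases i using Fin.lastCases with
    | cast i =>
      exact ((ih i).comp measurePreserving_fst).comp (measurePreserving_prod_init_last k)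
    | last =>
      exact ((hφ.measurePreserving hK).comp ((ih (Fin.last k)).prod (MeasurePreserving.id _))).comp
        (measurePreserving_prod_init_last k)

variable {w : α → ℝ}

theorem memLp_prod_chainState (hφ : IsUpdateFunction K φ) (hK : K.Invariant π)
    (hw : MemLp w ∞ π) (k : ℕ) :
    MemLp (fun z : α × (Fin k → Cube s) => ∏ i, w (chainState φ z.1 z.2 i) ^ 2) ∞
      (π.prod volume) := by
  have hsq (i : Fin (k + 1)) (_ : i ∈ Finset.univ) :
      MemLp (fun z : α × (Fin k → Cube s) => w (chainState φ z.1 z.2 i) ^ 2) ∞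
        (π.prod volume) := by
    simp only [sq]
    exact (hw.mul' (r := ∞) hw).comp_measurePreserving
      (measurePreserving_chainState hφ hK k i)
  simpa using MemLp.prod' hsq

theorem memLp_mul_prod_chainState (hφ : IsUpdateFunction K φ) (hK : K.Invariant π)
    (hw : MemLp w ∞ π) {f : α → ℝ} (hf : MemLp f 2 π) (k : ℕ) :
    MemLp (fun z : α × (Fin k → Cube s) => f z.1 * ∏ i, w (chainState φ z.1 z.2 i) ^ 2) 2
      (π.prod volume) :=
  (memLp_prod_chainState hφ hK hw k).mul' (r := 2)
    (hf.comp_measurePreserving (measurePreserving_fst (ν := volume)))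

theorem integrable_prod_chainState (hφ : IsUpdateFunction K φ) (hK : K.Invariant π)
    (hw : MemLp w ∞ π) {f g : α → ℝ} (hf : MemLp f 2 π) (hg : MemLp g 2 π) (k : ℕ) :
    Integrable (fun z : α × (Fin k → Cube s) => f z.1 * (∏ i, w (chainState φ z.1 z.2 i) ^ 2)
      * g (chainState φ z.1 z.2 (Fin.last k))) (π.prod volume) :=
  (memLp_mul_prod_chainState hφ hK hw hf k).integrable_mul
    (hg.comp_measurePreserving (measurePreserving_chainState hφ hK k (Fin.last k)))

variable [IsMarkovKernel K]

theorem integral_update (hφ : IsUpdateFunction K φ) (hK : K.Invariant π) (g : Lp ℝ 2 π) :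
    (fun x => ∫ t, g (φ x t)) =ᵐ[π] markovOperator K π hK g := by
  filter_upwards [markovOperator_coeFn hK g] with x hx
  rw [hx, ← hφ.map_eq, integral_map hφ.measurable.of_uncurry_left.aemeasurable
    (Lp.stronglyMeasurable g).aestronglyMeasurable]

theorem integral_mul_chainState_last_succ (hφ : IsUpdateFunction K φ) (hK : K.Invariant π) {k : ℕ}
    {F : α × (Fin k → Cube s) → ℝ} (hF : MemLp F 2 (π.prod volume)) (g : Lp ℝ 2 π) :
    ∫ z : α × (Fin (k + 1) → Cube s), F (z.1, Fin.init z.2)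
        * g (chainState φ z.1 z.2 (Fin.last (k + 1))) ∂(π.prod volume)
      = ∫ z : α × (Fin k → Cube s), F z
        * markovOperator K π hK g (chainState φ z.1 z.2 (Fin.last k)) ∂(π.prod volume) := by
  have hX := measurePreserving_chainState hφ hK k (Fin.last k)
  let H (z : (α × (Fin k → Cube s)) × Cube s) : ℝ :=
    F z.1 * g (φ (chainState φ z.1.1 z.1.2 (Fin.last k)) z.2)
  have hH : Integrable H ((π.prod volume).prod volume) :=
    (hF.comp_measurePreserving measurePreserving_fst).integrable_mul
      ((Lp.memLp g).comp_measurePreserving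
        ((hφ.measurePreserving hK).comp (hX.prod (MeasurePreserving.id volume))))
  have hpeel := measurePreserving_prod_init_last (γ := Cube s) (π := π) k
  calc _ = ∫ z, H z ∂((π.prod volume).prod volume) := by
        rw [← hpeel.map_eq] at hH ⊢
        exact (integral_map hpeel.aemeasurable hH.aestronglyMeasurable).symm
    _ = _ := by
        rw [integral_prod _ hH]
        refine integral_congr_ae ?_
        filter_upwards [hX.quasiMeasurePreserving.ae (integral_update hφ hK g)] with z hz
        rw [← hz, ← integral_const_mul]

theorem integral_prod_chainState (hφ : IsUpdateFunction K φ) (hK : K.Invariant π)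
    (hw : MemLp w ∞ π) (f g : Lp ℝ 2 π) (k : ℕ) :
    ∫ z : α × (Fin k → Cube s), f z.1 * (∏ i, w (chainState φ z.1 z.2 i) ^ 2)
        * g (chainState φ z.1 z.2 (Fin.last k)) ∂(π.prod volume)
      = inner ℝ (mulOperator hw f) ((tiltedOperator hK hw ^ k) (mulOperator hw g)) := by
  induction k generalizing g with
  | zero =>
    rw [pow_zero, one_apply_eq_self, L2.inner_def, integral_prod _
      (integrable_prod_chainState hφ hK hw (Lp.memLp f) (Lp.memLp g) 0)]
    refine integral_congr_ae ?_
    filter_upwards [mulOperator_coeFn hw f, mulOperator_coeFn hw g] with x hf hg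
    simp [chainState_zero, hf, hg]
    ring
  | succ k ih =>
    have hX := (measurePreserving_chainState hφ hK (k + 1) (Fin.last _)).quasiMeasurePreserving
    calc _ = ∫ z : α × (Fin (k + 1) → Cube s),
          f z.1 * (∏ i, w (chainState φ z.1 (Fin.init z.2) i) ^ 2)
            * mulOperator hw (mulOperator hw g) (chainState φ z.1 z.2 (Fin.last (k + 1)))
            ∂(π.prod volume) := by
          refine integral_congr_ae ?_
          filter_upwards [hX.ae (mulOperator_coeFn hw g),
            hX.ae (mulOperator_coeFn hw (mulOperator hw g))] with z hg hg'
          rw [hg', hg, Fin.prod_univ_castSucc]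
          simp only [chainState_castSucc]
          ring
      _ = ∫ z : α × (Fin k → Cube s), f z.1 * (∏ i, w (chainState φ z.1 z.2 i) ^ 2)
            * markovOperator K π hK (mulOperator hw (mulOperator hw g))
              (chainState φ z.1 z.2 (Fin.last k)) ∂(π.prod volume) :=
          integral_mul_chainState_last_succ hφ hK
            (memLp_mul_prod_chainState hφ hK hw (Lp.memLp f) k) (mulOperator hw (mulOperator hw g))
      _ = _ := by
          rw [ih, pow_succ]
          rfl

end FeynmanKac

section Visits

theorem measureReal_abs_ge_le {Ω : Type*} [MeasurableSpace Ω] {μ : Measure Ω} [IsFiniteMeasure μ]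
    {X : Ω → ℝ} {c : NNReal} (hX : HasSubgaussianMGF X c μ) {ε : ℝ} (hε : 0 ≤ ε) :
    μ.real {ω | ε ≤ |X ω|} ≤ 2 * Real.exp (-ε ^ 2 / (2 * c)) := by
  have hunion : {ω | ε ≤ |X ω|} = {ω | ε ≤ X ω} ∪ {ω | ε ≤ (-X) ω} := by
    ext ω
    exact le_abs (a := ε) (b := X ω)
  rw [hunion, two_mul]
  exact (measureReal_union_le _ _).trans (add_le_add (hX.measure_ge_le hε)
    (hX.neg.measure_ge_le hε))

/-- The number of visits of the chain `chainState φ x v` to the set `B`, counting the initial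
state `x`. -/
noncomputable def visits {β γ : Type*} (φ : β → γ → β) (x : β) {k : ℕ} (v : Fin k → γ)
    (B : Set β) : ℝ :=
  ∑ i, B.indicator (fun _ => 1) (chainState φ x v i)

theorem visits_mono {β γ : Type*} (φ : β → γ → β) (x : β) {k : ℕ} (v : Fin k → γ) :
    Monotone (visits φ x v) := fun _ _ h =>
  Finset.sum_le_sum fun _ _ => Set.indicator_le_indicator_of_subset h (fun _ => zero_le_one) _

theorem exp_mul_visits {β γ : Type*} (φ : β → γ → β) (x : β) {k : ℕ} (v : Fin k → γ) (B : Set β)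
    (θ : ℝ) : Real.exp (θ * visits φ x v B) = ∏ i, visitWeight θ B (chainState φ x v i) ^ 2 := by
  simp only [visits, Finset.mul_sum, Real.exp_sum, visitWeight_sq]

theorem measurable_visits {β γ : Type*} [MeasurableSpace β] [MeasurableSpace γ] {φ : β → γ → β}
    (hφ : Measurable (Function.uncurry φ)) {B : Set β} (hB : MeasurableSet B) (k : ℕ) :
    Measurable fun z : β × (Fin k → γ) => visits φ z.1 z.2 B :=
  Finset.measurable_sum _ fun i _ =>
    (measurable_const.indicator hB).comp (measurable_chainState hφ k i)

variable {α : Type*} [MeasurableSpace α] {K : Kernel α α} {π : Measure α}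
  [IsProbabilityMeasure π] {s : ℕ} {φ : α → Cube s → α} {B : Set α}

theorem integrable_exp_mul_visits (hφ : IsUpdateFunction K φ) (hK : K.Invariant π)
    (hB : MeasurableSet B) (k : ℕ) (θ : ℝ) :
    Integrable (fun z : α × (Fin k → Cube s) => Real.exp (θ * visits φ z.1 z.2 B))
      (π.prod volume) := by
  simp only [exp_mul_visits]
  exact (memLp_prod_chainState hφ hK (memLp_top_visitWeight θ hB) k).integrable le_top

variable [IsMarkovKernel K]

theorem mgf_visits_eq (hφ : IsUpdateFunction K φ) (hK : K.Invariant π)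
    (hB : MeasurableSet B) (k : ℕ) (θ : ℝ) :
    mgf (fun z : α × (Fin k → Cube s) => visits φ z.1 z.2 B) (π.prod volume) θ
      = inner ℝ (mulOperator (memLp_top_visitWeight θ hB) (Lp.const 2 π 1))
        ((tiltedOperator hK (memLp_top_visitWeight θ hB) ^ k)
          (mulOperator (memLp_top_visitWeight θ hB) (Lp.const 2 π 1))) := by
  rw [← integral_prod_chainState hφ, mgf]
  refine integral_congr_ae ?_
  filter_upwards [measurePreserving_fst.quasiMeasurePreserving.ae (Lp.coeFn_const 2 π (1 : ℝ)),
    (measurePreserving_chainState hφ hK k (Fin.last k)).quasiMeasurePreserving.ae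
      (Lp.coeFn_const 2 π (1 : ℝ))] with z hfst hlast
  rw [exp_mul_visits, hfst, hlast, Function.const_apply, Function.const_apply, one_mul, mul_one]

theorem mgf_visits_le (hφ : IsUpdateFunction K φ) (hK : K.IsReversible π)
    (hVB : VarianceBounding K π hK) (hB : MeasurableSet B) (k : ℕ) (θ : ℝ) :
    mgf (fun z : α × (Fin k → Cube s) => visits φ z.1 z.2 B) (π.prod volume) θ
      ≤ mgfBound (specSup₀ K π hK) (π.real B) θ ^ (k + 1) := by
  rw [mgf_visits_eq hφ hK.invariant hB]
  have hT := norm_tiltedOperator_visitWeight_le hK hVB hB θ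
  have hM := norm_sq_mulOperator_visitWeight_le (π := π) hB (specSup₀_nonneg hK)
    (specSup₀_lt_one hVB) θ
  set g := mulOperator (memLp_top_visitWeight θ hB) (Lp.const 2 π (1 : ℝ))
  set T := tiltedOperator hK.invariant (memLp_top_visitWeight θ hB)
  set m := mgfBound (specSup₀ K π hK) (π.real B) θ
  calc inner ℝ g ((T ^ k) g) ≤ ‖g‖ * (‖T‖ ^ k * ‖g‖) :=
        (real_inner_le_norm _ _).trans
          (mul_le_mul_of_nonneg_left (norm_pow_apply_le T k g) (norm_nonneg g))
    _ = ‖T‖ ^ k * ‖g‖ ^ 2 := by ring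
    _ ≤ m ^ k * m :=
        mul_le_mul (pow_le_pow_left₀ (norm_nonneg _) hT k) hM (sq_nonneg _)
          (pow_nonneg (mgfBound_pos _ _ _).le k)
    _ = m ^ (k + 1) := (pow_succ m k).symm

theorem hasSubgaussianMGF_visits_sub (hφ : IsUpdateFunction K φ) (hK : K.IsReversible π)
    (hVB : VarianceBounding K π hK) (hB : MeasurableSet B) (k : ℕ) {c : NNReal}
    (hc : c = (k + 1) / 2 * ((1 + specSup₀ K π hK) / (1 - specSup₀ K π hK))) :
    HasSubgaussianMGF (fun z : α × (Fin k → Cube s) => visits φ z.1 z.2 B - (k + 1) * π.real B)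
      c (π.prod volume) := by
  refine ⟨fun θ => ?_, fun θ => ?_⟩
  · simp only [mul_sub, Real.exp_sub]
    exact (integrable_exp_mul_visits hφ hK.invariant hB k θ).div_const _
  · simp only [sub_eq_add_neg, mgf_add_const]
    refine (mul_le_mul_of_nonneg_right (mgf_visits_le hφ hK hVB hB k θ)
      (Real.exp_nonneg _)).trans_eq ?_
    rw [mgfBound, ← Real.exp_nat_mul, ← Real.exp_add, hc]
    push_cast
    ring_nf

theorem measureReal_abs_visits_sub_ge_le (hφ : IsUpdateFunction K φ) (hK : K.IsReversible π)
    (hVB : VarianceBounding K π hK) (hB : MeasurableSet B) (k : ℕ) {ε : ℝ} (hε : 0 ≤ ε) :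
    (π.prod volume).real {z : α × (Fin k → Cube s) |
        ε ≤ |visits φ z.1 z.2 B - (k + 1) * π.real B|}
      ≤ 2 * Real.exp (-ε ^ 2 /
        ((k + 1) * ((1 + specSup₀ K π hK) / (1 - specSup₀ K π hK)))) := by
  have hl := specSup₀_nonneg hK
  have hl1 := specSup₀_lt_one hVB
  have hc : 0 ≤ (k + 1) / 2 * ((1 + specSup₀ K π hK) / (1 - specSup₀ K π hK)) :=
    mul_nonneg (by positivity) (div_nonneg (by linarith) (by linarith))
  refine (measureReal_abs_ge_le (hasSubgaussianMGF_visits_sub hφ hK hVB hB k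
    (Real.coe_toNNReal _ hc)) hε).trans_eq ?_
  rw [Real.coe_toNNReal _ hc, ← mul_assoc, mul_div_cancel₀ _ two_ne_zero]

end Visits

section ChangeOfMeasure

variable {α Ω : Type*} [MeasurableSpace α] [MeasurableSpace Ω] {π ν : Measure α} {τ : Measure Ω}
  {S : Set (α × Ω)}

theorem sq_lpNorm_two {f : α → ℝ} (hf : MemLp f 2 π) : lpNorm f 2 π ^ 2 = ∫ x, f x ^ 2 ∂π := by
  rw [← toReal_eLpNorm hf.1, ← Lp.norm_toLp f hf, ← real_inner_self_eq_norm_sq, inner_toLp]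
  simp only [← sq]

theorem prod_eq_withDensity_rnDeriv [SigmaFinite π] [SigmaFinite ν] [SFinite τ] (hνπ : ν ≪ π) :
    ν.prod τ = (π.prod τ).withDensity fun z => ν.rnDeriv π z.1 := by
  rw [← prod_withDensity_left (Measure.measurable_rnDeriv ν π),
    Measure.withDensity_rnDeriv_eq ν π hνπ]

theorem measureReal_prod_eq_integral_rnDeriv [SigmaFinite π] [SigmaFinite ν] [SFinite τ]
    (hνπ : ν ≪ π) (hS : MeasurableSet S) :
    (ν.prod τ).real S
      = ∫ z, (ν.rnDeriv π z.1).toReal * S.indicator (fun _ => 1) z ∂(π.prod τ) := by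
  have hfin : ∀ᵐ z ∂(π.prod τ), ν.rnDeriv π z.1 < ∞ :=
    Measure.quasiMeasurePreserving_fst.ae (Measure.rnDeriv_lt_top ν π)
  have hmeas : Measurable fun z : α × Ω => ν.rnDeriv π z.1 :=
    (Measure.measurable_rnDeriv ν π).comp measurable_fst
  calc (ν.prod τ).real S = ∫ z, S.indicator (fun _ => 1) z ∂(ν.prod τ) :=
        (integral_indicator_one hS).symm
    _ = _ := by
        rw [prod_eq_withDensity_rnDeriv hνπ, integral_withDensity_eq_integral_toReal_smul hmeas
          hfin]
        rfl

theorem measureReal_prod_le [IsFiniteMeasure π] [SigmaFinite ν] [IsProbabilityMeasure τ]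
    (hνπ : ν ≪ π) (hν : MemLp (fun x => (ν.rnDeriv π x).toReal) 2 π) (hS : MeasurableSet S) :
    (ν.prod τ).real S
      ≤ lpNorm (fun x => (ν.rnDeriv π x).toReal) 2 π * √((π.prod τ).real S) := by
  have hsq : ∫ z, S.indicator (fun _ => (1 : ℝ)) z ^ 2 ∂(π.prod τ) = (π.prod τ).real S := by
    rw [← integral_indicator_one hS]
    congr 1 with z
    by_cases hz : z ∈ S <;> simp [hz]
  have hν_sq : ∫ z, (ν.rnDeriv π z.1).toReal ^ 2 ∂(π.prod τ)
      = lpNorm (fun x => (ν.rnDeriv π x).toReal) 2 π ^ 2 := by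
    rw [sq_lpNorm_two hν, integral_fun_fst fun x => (ν.rnDeriv π x).toReal ^ 2, probReal_univ,
      one_smul]
  refine le_of_sq_le_sq ?_ (mul_nonneg lpNorm_nonneg (Real.sqrt_nonneg _))
  rw [mul_pow, Real.sq_sqrt measureReal_nonneg, ← hν_sq, ← hsq,
    measureReal_prod_eq_integral_rnDeriv hνπ hS]
  exact sq_integral_mul_le (hν.comp_measurePreserving measurePreserving_fst)
    (memLp_indicator_const 2 hS 1 (Or.inr (measure_ne_top _ S)))

theorem one_le_lpNorm_rnDeriv [IsProbabilityMeasure π] [IsProbabilityMeasure ν] (hνπ : ν ≪ π)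
    (hν : MemLp (fun x => (ν.rnDeriv π x).toReal) 2 π) :
    1 ≤ lpNorm (fun x => (ν.rnDeriv π x).toReal) 2 π := by
  simpa using measureReal_prod_le (τ := π) hνπ hν MeasurableSet.univ

end ChangeOfMeasure

section Bias

variable {α : Type*} [MeasurableSpace α] {K : Kernel α α} {π ν : Measure α}
  {s : ℕ} {φ : α → Cube s → α} {ψ : Cube s → α} {B : Set α}

theorem IsGeneratorFunction.measurePreserving (hψ : IsGeneratorFunction ν ψ) :
    MeasurePreserving ψ volume ν := by
  refine ⟨hψ.measurable, ?_⟩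
  ext A hA
  rw [Measure.map_apply hψ.measurable hA, hψ.measure_eq A hA]
  rfl

theorem IsGeneratorFunction.measurePreserving_zero_tail [IsProbabilityMeasure ν]
    (hψ : IsGeneratorFunction ν ψ) (k : ℕ) :
    MeasurePreserving (fun u : Fin (k + 1) → Cube s => (ψ (u 0), Fin.tail u))
      volume (ν.prod volume) :=
  (hψ.measurePreserving.prod (MeasurePreserving.id volume)).comp
    (PullBack.measurePreserving_zero_tail k)

variable [IsMarkovKernel K] [IsProbabilityMeasure π]

theorem abs_sum_inner_markovOperator_pow_sub_le (hK : K.IsReversible π) {h : Lp ℝ 2 π}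
    (hh : ∫ x, h x ∂π = 1) (f : Lp ℝ 2 π) (n : ℕ) :
    |∑ k ∈ Finset.range n, (inner ℝ h ((markovOperator K π hK.invariant ^ k) f) - ∫ x, f x ∂π)|
      ≤ (∑ k ∈ Finset.range n, specSup₀ K π hK ^ k) * ‖f‖ * ‖h - Lp.const 2 π 1‖ := by
  set f₀ := f - (∫ x, f x ∂π) • Lp.const 2 π (1 : ℝ)
  have hf₀_mem : f₀ ∈ L2Zero π := by
    rw [mem_L2Zero_iff, inner_sub_right, real_inner_smul_right, real_inner_self_eq_norm_sq,
      norm_const_one, inner_const_one]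
    ring
  have hf₀_norm : ‖f₀‖ ≤ ‖f‖ := by
    simpa only [inner_const_one] using norm_sub_inner_smul_le norm_const_one f
  have hterm (k : ℕ) : inner ℝ h ((markovOperator K π hK.invariant ^ k) f) - ∫ x, f x ∂π
      = inner ℝ (h - Lp.const 2 π 1) ((markovOperator K π hK.invariant ^ k) f₀) := by
    have := inner_pow_apply_sub_inner (isSymmetric_markovOperator hK) norm_const_one
      (markovOperator_const_one hK.invariant) (h := h) (by rw [inner_const_one, hh]) f k
    simpa only [inner_const_one, ← ContinuousLinearMap.toLinearMap_pow,
      ContinuousLinearMap.coe_coe] using this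
  simp only [hterm, ← inner_sum]
  calc _ ≤ ‖h - Lp.const 2 π 1‖
        * ‖∑ k ∈ Finset.range n, (markovOperator K π hK.invariant ^ k) f₀‖ :=
        abs_real_inner_le_norm _ _
    _ ≤ ‖h - Lp.const 2 π 1‖ * ((∑ k ∈ Finset.range n, specSup₀ K π hK ^ k) * ‖f‖) := by
        gcongr
        refine (norm_sum_markovOperator_pow_le hK n hf₀_mem).trans ?_
        gcongr
        exact Finset.sum_nonneg fun k _ => pow_nonneg (specSup₀_nonneg hK) k
    _ = _ := mul_comm _ _

theorem tiltedOperator_const_one (hK : K.Invariant π) :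
    tiltedOperator hK (memLp_top_const (1 : ℝ)) = markovOperator K π hK := by
  ext1 f
  simp only [tiltedOperator, ContinuousLinearMap.comp_apply, mulOperator_const_one]

theorem integral_mul_chainState_last (hφ : IsUpdateFunction K φ) (hK : K.Invariant π)
    (f g : Lp ℝ 2 π) (k : ℕ) :
    ∫ z : α × (Fin k → Cube s), f z.1 * g (chainState φ z.1 z.2 (Fin.last k)) ∂(π.prod volume)
      = inner ℝ f ((markovOperator K π hK ^ k) g) := by
  simpa [mulOperator_const_one, tiltedOperator_const_one] using
    integral_prod_chainState hφ hK (memLp_top_const (1 : ℝ)) f g k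

variable [IsProbabilityMeasure ν]

theorem measureReal_pullBack (hφ : IsUpdateFunction K φ) (hK : K.Invariant π)
    (hψ : IsGeneratorFunction ν ψ) (hνπ : ν ≪ π)
    (hν : MemLp (fun x => (ν.rnDeriv π x).toReal) 2 π) (hB : MeasurableSet B) (k : ℕ) :
    volume.real (pullBack φ ψ k B)
      = inner ℝ (hν.toLp _) ((markovOperator K π hK ^ k)
        (indicatorConstLp 2 hB (measure_ne_top π B) 1)) := by
  have hX := measurePreserving_chainState hφ hK k (Fin.last k)
  have hS : MeasurableSet {z : α × (Fin k → Cube s) | chainState φ z.1 z.2 (Fin.last k) ∈ B} :=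
    hX.measurable hB
  calc volume.real (pullBack φ ψ k B)
      = (ν.prod volume).real {z | chainState φ z.1 z.2 (Fin.last k) ∈ B} :=
        (hψ.measurePreserving_zero_tail k).measureReal_preimage hS.nullMeasurableSet
    _ = _ := by
        rw [measureReal_prod_eq_integral_rnDeriv hνπ hS, ← integral_mul_chainState_last hφ]
        refine integral_congr_ae ?_
        filter_upwards [Measure.quasiMeasurePreserving_fst.ae hν.coeFn_toLp,
          hX.quasiMeasurePreserving.ae (indicatorConstLp_coeFn (p := 2) (hs := hB)
            (hμs := measure_ne_top π B) (c := (1 : ℝ)))] with z hfst hlast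
        rw [hfst, hlast]
        rfl

theorem abs_sum_measureReal_pullBack_sub_le (hφ : IsUpdateFunction K φ) (hK : K.IsReversible π)
    (hψ : IsGeneratorFunction ν ψ) (hνπ : ν ≪ π)
    (hν : MemLp (fun x => (ν.rnDeriv π x).toReal) 2 π) (hB : MeasurableSet B) (n : ℕ) :
    |∑ k ∈ Finset.range n, volume.real (pullBack φ ψ k B) - n * π.real B|
      ≤ (∑ k ∈ Finset.range n, specSup₀ K π hK ^ k)
        * lpNorm (fun x => (ν.rnDeriv π x).toReal - 1) 2 π := by
  have hmean : ∫ x, hν.toLp (fun x => (ν.rnDeriv π x).toReal) x ∂π = 1 := by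
    rw [integral_congr_ae hν.coeFn_toLp, Measure.integral_toReal_rnDeriv hνπ, probReal_univ]
  have hind : ‖indicatorConstLp 2 hB (measure_ne_top π B) (1 : ℝ)‖ ≤ 1 := by
    rw [norm_indicatorConstLp two_ne_zero ENNReal.ofNat_ne_top, norm_one, one_mul]
    exact Real.rpow_le_one measureReal_nonneg measureReal_le_one (by norm_num)
  have hdist : ‖hν.toLp (fun x => (ν.rnDeriv π x).toReal) - Lp.const 2 π 1‖
      = lpNorm (fun x => (ν.rnDeriv π x).toReal - 1) 2 π := by
    have hν1 : MemLp (fun x => (ν.rnDeriv π x).toReal - 1) 2 π := hν.sub (memLp_const 1)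
    rw [← toReal_eLpNorm hν1.1, ← Lp.norm_toLp _ hν1]
    exact congrArg norm (hν.toLp_sub (memLp_const 1)).symm
  have hsum := abs_sum_inner_markovOperator_pow_sub_le hK hmean
    (indicatorConstLp 2 hB (measure_ne_top π B) 1) n
  simp only [← measureReal_pullBack hφ hK.invariant hψ hνπ hν hB, integral_indicatorConstLp hB,
    smul_eq_mul, mul_one, Finset.sum_sub_distrib, Finset.sum_const, Finset.card_range,
    nsmul_eq_mul, hdist] at hsum
  refine hsum.trans (mul_le_mul_of_nonneg_right (mul_le_of_le_one_right ?_ hind) lpNorm_nonneg)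
  exact Finset.sum_nonneg fun k _ => pow_nonneg (specSup₀_nonneg hK) k

end Bias

section Deviation

theorem mul_sqrt_two_mul_exp_eq {H N : ℝ} (hH : 0 < H) (hN : 0 < N) :
    H * √(2 * Real.exp (-(2 * Real.log (N ^ 2 * H)))) = √2 / N ^ 2 := by
  have hexp : Real.exp (-(2 * Real.log (N ^ 2 * H))) = ((N ^ 2 * H)⁻¹) ^ 2 := by
    rw [← Real.exp_log (inv_pos.2 (mul_pos (pow_pos hN 2) hH)), ← Real.exp_nat_mul, Real.log_inv,
      Nat.cast_ofNat, mul_neg]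
  rw [hexp, Real.sqrt_mul zero_le_two, Real.sqrt_sq (by positivity)]
  field_simp

theorem sub_one_mul_sqrt_two_div_sq_lt_one {N : ℝ} (hN : 1 ≤ N) : (N - 1) * (√2 / N ^ 2) < 1 := by
  have hsqrt : √2 ≤ 2 := Real.sqrt_le_iff.2 (by norm_num)
  rw [mul_div_assoc', div_lt_one (by positivity)]
  nlinarith [mul_le_mul_of_nonneg_left hsqrt (sub_nonneg.2 hN), sq_nonneg (N - 1)]

theorem exists_forall_notMem_of_sum_measureReal_lt_one {Ω ι : Type*} [MeasurableSpace Ω]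
    {μ : Measure Ω} [IsProbabilityMeasure μ] {I : Finset ι} {S : ι → Set Ω}
    (h : ∑ i ∈ I, μ.real (S i) < 1) : ∃ ω, ∀ i ∈ I, ω ∉ S i := by
  by_contra! hcover
  have huniv : ⋃ i ∈ I, S i = Set.univ :=
    Set.eq_univ_of_forall fun ω => by simpa using hcover ω
  have hle := measureReal_biUnion_finset_le (μ := μ) I S
  rw [huniv, probReal_univ] at hle
  exact h.not_ge hle

variable {α : Type*} [MeasurableSpace α] {K : Kernel α α} [IsMarkovKernel K] {π ν : Measure α}
  [IsProbabilityMeasure π] [IsProbabilityMeasure ν] {s : ℕ} {φ : α → Cube s → α}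
  {ψ : Cube s → α}

theorem measureReal_abs_visits_generator_sub_ge_le (hK : K.IsReversible π)
    (hVB : VarianceBounding K π hK) (hνπ : ν ≪ π)
    (hν : MemLp (fun x => (ν.rnDeriv π x).toReal) 2 π) {B : Set α} (hB : MeasurableSet B)
    (hφ : IsUpdateFunction K φ) (hψ : IsGeneratorFunction ν ψ) (k : ℕ) {ε : ℝ} (hε : 0 ≤ ε) :
    volume.real {u : Fin (k + 1) → Cube s |
        ε ≤ |visits φ (ψ (u 0)) (Fin.tail u) B - (k + 1) * π.real B|}
      ≤ lpNorm (fun x => (ν.rnDeriv π x).toReal) 2 π * √(2 * Real.exp (-ε ^ 2 /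
        ((k + 1) * ((1 + specSup₀ K π hK) / (1 - specSup₀ K π hK))))) := by
  have hS : MeasurableSet {z : α × (Fin k → Cube s) |
      ε ≤ |visits φ z.1 z.2 B - (k + 1) * π.real B|} :=
    measurableSet_le measurable_const
      ((measurable_visits hφ.measurable hB k).sub_const _).abs
  calc _ = (ν.prod volume).real {z : α × (Fin k → Cube s) |
          ε ≤ |visits φ z.1 z.2 B - (k + 1) * π.real B|} :=
        (hψ.measurePreserving_zero_tail k).measureReal_preimage hS.nullMeasurableSet
    _ ≤ _ := (measureReal_prod_le hνπ hν hS).trans <|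
        mul_le_mul_of_nonneg_left
          (Real.sqrt_le_sqrt (measureReal_abs_visits_sub_ge_le hφ hK hVB hB k hε)) lpNorm_nonneg

theorem exists_forall_abs_visits_sub_le (hK : K.IsReversible π) (hVB : VarianceBounding K π hK)
    (hνπ : ν ≪ π) (hν : MemLp (fun x => (ν.rnDeriv π x).toReal) 2 π) {Γ : Finset (Set α)}
    (hΓ : ∀ C ∈ Γ, MeasurableSet C) (hΓ_empty : ∅ ∈ Γ) (hφ : IsUpdateFunction K φ)
    (hψ : IsGeneratorFunction ν ψ) (k : ℕ) :
    ∃ u : Fin (k + 1) → Cube s, ∀ B ∈ Γ,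
      |visits φ (ψ (u 0)) (Fin.tail u) B - (k + 1) * π.real B|
        ≤ √((k + 1) * ((1 + specSup₀ K π hK) / (1 - specSup₀ K π hK))
          * (2 * Real.log ((Γ.card : ℝ) ^ 2
            * lpNorm (fun x => (ν.rnDeriv π x).toReal) 2 π))) := by
  classical
  set H := lpNorm (fun x => (ν.rnDeriv π x).toReal) 2 π
  set c := (k + 1) * ((1 + specSup₀ K π hK) / (1 - specSup₀ K π hK))
  have hH : 1 ≤ H := one_le_lpNorm_rnDeriv hνπ hν
  have hc : 0 < c := mul_pos (by positivity) <|
    div_pos (by linarith [specSup₀_nonneg hK]) (sub_pos.2 (specSup₀_lt_one hVB))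
  have hcard : 1 ≤ Γ.card := Finset.card_pos.2 ⟨∅, hΓ_empty⟩
  have hN : (1 : ℝ) ≤ Γ.card := mod_cast hcard
  have hlog : 0 ≤ 2 * Real.log ((Γ.card : ℝ) ^ 2 * H) := mul_nonneg zero_le_two <|
    Real.log_nonneg (one_le_mul_of_one_le_of_one_le (one_le_pow₀ hN) hH)
  set ε := √(c * (2 * Real.log ((Γ.card : ℝ) ^ 2 * H)))
  have hbad (B : Set α) (hB : B ∈ Γ.erase ∅) : volume.real {u : Fin (k + 1) → Cube s |
      ε ≤ |visits φ (ψ (u 0)) (Fin.tail u) B - (k + 1) * π.real B|} ≤ √2 / (Γ.card : ℝ) ^ 2 := by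
    refine (measureReal_abs_visits_generator_sub_ge_le hK hVB hνπ hν
      (hΓ B (Finset.mem_of_mem_erase hB)) hφ hψ k (Real.sqrt_nonneg _)).trans_eq ?_
    rw [Real.sq_sqrt (mul_nonneg hc.le hlog), neg_div, mul_div_cancel_left₀ _ hc.ne']
    exact mul_sqrt_two_mul_exp_eq (zero_lt_one.trans_le hH) (zero_lt_one.trans_le hN)
  -- The empty set is never visited, so the union bound runs over `|Γ| - 1` sets only.
  obtain ⟨u, hu⟩ := exists_forall_notMem_of_sum_measureReal_lt_one <|
    (Finset.sum_le_card_nsmul _ _ _ hbad).trans_lt <| by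
      rw [Finset.card_erase_of_mem hΓ_empty, nsmul_eq_mul, Nat.cast_sub hcard, Nat.cast_one]
      exact sub_one_mul_sqrt_two_div_sq_lt_one hN
  refine ⟨u, fun B hB => ?_⟩
  rcases eq_or_ne B ∅ with rfl | hB_ne
  · simp [visits, ε]
  · exact (not_le.1 (hu B (Finset.mem_erase.2 ⟨hB_ne, hB⟩))).le

end Deviation

section Bracketing

theorem sqrt_mul_mul_div_self {n c : ℝ} (hn : 0 ≤ n) (hc : 0 ≤ c) (L : ℝ) :
    √(n * c * L) / n = √c * (√L / √n) := by
  rw [Real.sqrt_mul (mul_nonneg hn hc), Real.sqrt_mul hn, mul_assoc, mul_div_right_comm,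
    Real.sqrt_div_self]
  ring

variable {α : Type*} {s : ℕ} {φ : α → Cube s → α} {ψ : Cube s → α}

theorem localDiscrepancy_eq {k : ℕ} (u : Fin (k + 1) → Cube s) (A : Set α) :
    localDiscrepancy φ ψ u A = (visits φ (ψ (u 0)) (Fin.tail u) A
      - ∑ i ∈ Finset.range (k + 1), volume.real (pullBack φ ψ i A)) / (k + 1) := by
  rw [localDiscrepancy, Finset.sum_sub_distrib, visits, Finset.sum_range, one_div_mul_eq_div,
    Nat.cast_add_one]
  rfl

theorem monotone_sum_measureReal_pullBack (n : ℕ) :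
    Monotone fun A => ∑ i ∈ Finset.range n, volume.real (pullBack φ ψ i A) := fun _ _ h =>
  Finset.sum_le_sum fun _ _ => measureReal_mono fun _ hu => h hu

theorem abs_sub_le_of_bracket {β : Type*} [Preorder β] {f g : β → ℝ} (hf : Monotone f)
    (hg : Monotone g) {A B C : β} (hBA : B ≤ A) (hAC : A ≤ C) {p q ε b : ℝ}
    (hfB : |f B - p| ≤ ε) (hfC : |f C - q| ≤ ε) (hgB : |g B - p| ≤ b) (hgC : |g C - q| ≤ b) :
    |f A - g A| ≤ ε + b + (q - p) := by
  rw [abs_le] at *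
  constructor <;> linarith [hf hBA, hf hAC, hg hBA, hg hAC]

variable [MeasurableSpace α] {π : Measure α} [IsProbabilityMeasure π]

theorem pullBackDiscrepancy_le {𝒜 : Set (Set α)} {δ : ℝ} (hδ : 0 ≤ δ) {Γ : Finset (Set α)}
    (hΓ : IsDeltaCover π 𝒜 δ Γ) {k : ℕ} {u : Fin (k + 1) → Cube s} {ε b : ℝ}
    (hvisits : ∀ B ∈ Γ, |visits φ (ψ (u 0)) (Fin.tail u) B - (k + 1) * π.real B| ≤ ε)
    (hbias : ∀ B ∈ Γ, |∑ i ∈ Finset.range (k + 1), volume.real (pullBack φ ψ i B)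
      - (k + 1) * π.real B| ≤ b) :
    pullBackDiscrepancy 𝒜 φ ψ u ≤ ε / (k + 1) + b / (k + 1) + δ := by
  have hε : 0 ≤ ε := (abs_nonneg _).trans (hvisits ∅ hΓ.empty_mem)
  have hb : 0 ≤ b := (abs_nonneg _).trans (hbias ∅ hΓ.empty_mem)
  refine Real.iSup_le (fun ⟨A, hA⟩ => ?_) (by positivity)
  obtain ⟨C, hC, D, hD, hCA, hAD, hδ_le⟩ := hΓ.exists_bracket A hA
  rw [measureReal_sdiff (hCA.trans hAD) (hΓ.measurableSet C hC)] at hδ_le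
  have hgap := mul_le_mul_of_nonneg_left hδ_le (show (0 : ℝ) ≤ k + 1 by positivity)
  have hbracket := abs_sub_le_of_bracket (visits_mono φ (ψ (u 0)) (Fin.tail u))
    (monotone_sum_measureReal_pullBack (φ := φ) (ψ := ψ) (k + 1)) hCA hAD (hvisits C hC)
    (hvisits D hD) (hbias C hC) (hbias D hD)
  rw [localDiscrepancy_eq, abs_div, abs_of_pos (show (0 : ℝ) < k + 1 by positivity),
    ← add_div, div_add' _ _ _ (by positivity)]
  gcongr
  linarith

end Bracketing

end PullBack

theorem mainTheorem5_general {α : Type*} [MeasurableSpace α]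
    (K : Kernel α α) [IsMarkovKernel K]
    (π : Measure α) [IsProbabilityMeasure π] (hK : K.IsReversible π)
    (hVB : PullBack.VarianceBounding K π hK)
    (ν : Measure α) [IsProbabilityMeasure ν] (hνπ : ν ≪ π)
    (hν : MemLp (fun x => (ν.rnDeriv π x).toReal) 2 π)
    (𝒜 : Set (Set α)) (δ : ℝ) (hδ : 0 ≤ δ) (Γ : Finset (Set α))
    (hΓ : PullBack.IsDeltaCover π 𝒜 δ Γ)
    {s : ℕ} (φ : α → PullBack.Cube s → α) (hφ : PullBack.IsUpdateFunction K φ)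
    (ψ : PullBack.Cube s → α) (hψ : PullBack.IsGeneratorFunction ν ψ)
    (n : ℕ) (hn : 1 ≤ n) :
    ∃ u : Fin n → PullBack.Cube s,
      PullBack.pullBackDiscrepancy 𝒜 φ ψ u ≤
        √((1 + PullBack.specSup₀ K π hK) / (1 - PullBack.specSup₀ K π hK))
            * (√(2 * Real.log ((Γ.card : ℝ) ^ 2
                * lpNorm (fun x => (ν.rnDeriv π x).toReal) 2 π)) / √(n : ℝ))
          + (1 - PullBack.specSup₀ K π hK ^ n) / ((n : ℝ) * (1 - PullBack.specSup₀ K π hK))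
            * lpNorm (fun x => (ν.rnDeriv π x).toReal - 1) 2 π
          + δ := by
  obtain ⟨k, rfl⟩ := Nat.exists_eq_add_of_le' hn
  obtain ⟨u, hvisits⟩ := PullBack.exists_forall_abs_visits_sub_le hK hVB hνπ hν hΓ.measurableSet
    hΓ.empty_mem hφ hψ k
  have hbias (B : Set α) (hB : B ∈ Γ) := PullBack.abs_sum_measureReal_pullBack_sub_le hφ hK hψ hνπ
    hν (hΓ.measurableSet B hB) (k + 1)
  push_cast at hbias ⊢
  refine ⟨u, (PullBack.pullBackDiscrepancy_le hδ hΓ hvisits hbias).trans_eq ?_⟩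
  have hΛ₀ := PullBack.specSup₀_nonneg hK
  have hgap : 0 < 1 - PullBack.specSup₀ K π hK := sub_pos.2 (PullBack.specSup₀_lt_one hVB)
  rw [PullBack.sqrt_mul_mul_div_self (by positivity) (by positivity), ← geom_sum_mul_neg,
    mul_div_mul_right _ _ hgap.ne', div_mul_eq_mul_div]

theorem mainTheorem5 {d : ℕ} (G : Set (EuclideanSpace ℝ (Fin d)))
    (K : Kernel G G) [IsMarkovKernel K]
    (π : Measure G) [IsProbabilityMeasure π] (hK : K.IsReversible π)
    (hVB : PullBack.VarianceBounding K π hK)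
    (ν : Measure G) [IsProbabilityMeasure ν] (hνπ : ν ≪ π)
    (hν : MemLp (fun x => (ν.rnDeriv π x).toReal) 2 π)
    (𝒜 : Set (Set G)) (h𝒜 : ∀ A ∈ 𝒜, MeasurableSet A)
    (δ : ℝ) (hδ : 0 < δ) (Γ : Finset (Set G)) (hΓ : PullBack.IsDeltaCover π 𝒜 δ Γ)
    {s : ℕ} (φ : G → PullBack.Cube s → G) (hφ : PullBack.IsUpdateFunction K φ)
    (ψ : PullBack.Cube s → G) (hψ : PullBack.IsGeneratorFunction ν ψ)
    (n : ℕ) (hn : 1 ≤ n) :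
    ∃ u : Fin n → PullBack.Cube s,
      PullBack.pullBackDiscrepancy 𝒜 φ ψ u ≤
        √((1 + PullBack.specSup₀ K π hK) / (1 - PullBack.specSup₀ K π hK))
            * (√(2 * Real.log ((Γ.card : ℝ) ^ 2
                * lpNorm (fun x => (ν.rnDeriv π x).toReal) 2 π)) / √(n : ℝ))
          + (1 - PullBack.specSup₀ K π hK ^ n) / ((n : ℝ) * (1 - PullBack.specSup₀ K π hK))
            * lpNorm (fun x => (ν.rnDeriv π x).toReal - 1) 2 π
          + δ := by
  exact mainTheorem5_general K π hK hVB ν hνπ hν 𝒜 δ hδ.le Γ hΓ φ hφ ψ hψ n hn
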